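/- Let $A=\{a,b\}$, let $A^+$ be the free semigroup on $A$, and let $\tau$ be the Prouhet--Thue--Morse substitution, i.e. the endomorphism of $A^+$ with $\tau(a)=ab$ and $\tau(b)=ba$. Let $L(\tau)\subseteq A^+$ be the set of nonempty factors of the words $\tau^k(x)$ ($x\in A$, $k\ge 0$), that is, the set of finite blocks of the Prouhet--Thue--Morse subshift. Let $\overline{\Omega}_A\mathsf S$ be the free profinite semigroup on $A$ (the profinite completion of $A^+$), and let $J(\tau)$ be the closure of $L(\tau)$ in $\overline{\Omega}_A\mathsf S$ with the elements of $L(\tau)$ removed; it is a regular $\mathcal J$-class of $\overline{\Omega}_A\mathsf S$. Let the Schützenberger group $G(\tau)$ be any maximal subgroup of $J(\tau)$, with the topology induced from $\overline{\Omega}_A\mathsf S$; it is a profinite group, which up to isomorphism does not depend on the choice. Then $G(\tau)$ is not relatively free: for no pseudovariety of groups $\mathsf V$ (class of finite groups closed under subgroups, homomorphic images and finite direct products) is $G(\tau)$ a free pro-$\mathsf V$ group, on any set, profinite space or pointed profinite space. In detail, $J(\tau)$ contains an idempotent and, for every idempotent $e\in J(\tau)$, the maximal subgroup of $\overline{\Omega}_A\mathsf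 S$ with identity element $e$ is not a free pro-$\mathsf V$ group for any pseudovariety of groups $\mathsf V$. -/

import Mathlib

universe u

/-! ### Free profinite semigroups -/

section FreeProfiniteSemigroup

/-- The congruences with finitely many classes on the free semigroup `A⁺`. -/
abbrev FiniteCon (A : Type) : Type := {c : Con (FreeSemigroup A) // Finite c.Quotient}

/-- The finite quotient semigroup of `A⁺` by a congruence with finitely many classes,
with the discrete topology. -/
def FiniteQuot {A : Type} (c : FiniteCon A) : Type := c.1.Quotient

instance {A : Type} (c : FiniteCon A) : Semigroup (FiniteQuot c) :=
  inferInstanceAs (Semigroup c.1.Quotient)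

instance {A : Type} (c : FiniteCon A) : Finite (FiniteQuot c) := c.2

instance {A : Type} (c : FiniteCon A) : TopologicalSpace (FiniteQuot c) := ⊥

instance {A : Type} (c : FiniteCon A) : DiscreteTopology (FiniteQuot c) := ⟨rfl⟩

/-- The canonical homomorphism from `A⁺` to the product of all its finite quotients. -/
def toFiniteQuots (A : Type) : FreeSemigroup A →ₙ* ((c : FiniteCon A) → FiniteQuot c) where
  toFun w := fun c => (Con.toQuotient w : c.1.Quotient)
  map_mul' _ _ := rfl

/-- The free profinite semigroup on the finite alphabet `A`: the profinite completion of `A⁺`,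
i.e. the closure of the image of `A⁺` in the product of all its finite quotients. -/
def FreeProfiniteSemigroup (A : Type) : Type :=
  (MulHom.srange (toFiniteQuots A)).topologicalClosure

namespace FreeProfiniteSemigroup

instance (A : Type) : Semigroup (FreeProfiniteSemigroup A) :=
  inferInstanceAs (Semigroup (MulHom.srange (toFiniteQuots A)).topologicalClosure)

instance (A : Type) : TopologicalSpace (FreeProfiniteSemigroup A) :=
  inferInstanceAs (TopologicalSpace (MulHom.srange (toFiniteQuots A)).topologicalClosure)

instance (A : Type) : ContinuousMul (FreeProfiniteSemigroup A) :=
  inferInstanceAs (ContinuousMul (MulHom.srange (toFiniteQuots A)).topologicalClosure)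

instance (A : Type) : T2Space (FreeProfiniteSemigroup A) :=
  inferInstanceAs (T2Space (MulHom.srange (toFiniteQuots A)).topologicalClosure)

instance (A : Type) : TotallyDisconnectedSpace (FreeProfiniteSemigroup A) :=
  inferInstanceAs (TotallyDisconnectedSpace (MulHom.srange (toFiniteQuots A)).topologicalClosure)

instance (A : Type) : CompactSpace (FreeProfiniteSemigroup A) :=
  isCompact_iff_compactSpace.mp
    (MulHom.srange (toFiniteQuots A)).isClosed_topologicalClosure.isCompact

/-- The canonical homomorphism from `A⁺` to the free profinite semigroup on `A`. -/
def ofWord (A : Type) : FreeSemigroup A →ₙ* FreeProfiniteSemigroup A where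
  toFun w := ⟨toFiniteQuots A w, subset_closure ⟨w, rfl⟩⟩
  map_mul' v w := Subtype.ext (map_mul (toFiniteQuots A) v w)

end FreeProfiniteSemigroup

end FreeProfiniteSemigroup

/-! ### Maximal subgroups of a semigroup -/

section MaximalSubgroup

/-- The local monoid `eSe` of a semigroup `S` at an idempotent `e`, with identity element `e`
and, when `S` has a topology, with the subspace topology. -/
def LocalMonoid {S : Type} [Semigroup S] {e : S} (_he : IsIdempotentElem e) : Type :=
  Subsemigroup.corner e

instance {S : Type} [Semigroup S] {e : S} (he : IsIdempotentElem e) : Semigroup (LocalMonoid he) :=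
  inferInstanceAs (Semigroup (Subsemigroup.corner e))

instance {S : Type} [Semigroup S] {e : S} (he : IsIdempotentElem e) : Monoid (LocalMonoid he) where
  one := ⟨e, (Subsemigroup.mem_corner_iff he).mpr ⟨he, he⟩⟩
  one_mul r := Subtype.ext ((Subsemigroup.mem_corner_iff he).mp r.2).1
  mul_one r := Subtype.ext ((Subsemigroup.mem_corner_iff he).mp r.2).2

instance {S : Type} [Semigroup S] [TopologicalSpace S] {e : S} (he : IsIdempotentElem e) :
    TopologicalSpace (LocalMonoid he) :=
  inferInstanceAs (TopologicalSpace (Subsemigroup.corner e))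

instance {S : Type} [Semigroup S] [TopologicalSpace S] [ContinuousMul S] {e : S}
    (he : IsIdempotentElem e) : ContinuousMul (LocalMonoid he) :=
  inferInstanceAs (ContinuousMul (Subsemigroup.corner e))

instance {S : Type} [Semigroup S] [TopologicalSpace S] [T2Space S] {e : S}
    (he : IsIdempotentElem e) : T2Space (LocalMonoid he) :=
  inferInstanceAs (T2Space (Subsemigroup.corner e))

instance {S : Type} [Semigroup S] [TopologicalSpace S] [TotallyDisconnectedSpace S] {e : S}
    (he : IsIdempotentElem e) : TotallyDisconnectedSpace (LocalMonoid he) :=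
  inferInstanceAs (TotallyDisconnectedSpace (Subsemigroup.corner e))

instance {S : Type} [Semigroup S] [TopologicalSpace S] [ContinuousMul S] [CompactSpace S]
    {e : S} (he : IsIdempotentElem e) : CompactSpace (LocalMonoid he) :=
  isCompact_iff_compactSpace.mp
    (isCompact_range ((continuous_const.mul continuous_id).mul continuous_const) :
      IsCompact (Set.range (fun r : S => e * r * e)))

/-- The maximal subgroup of a semigroup `S` with identity element the idempotent `e`: the group of
units of `eSe`, which is the `H`-class of `e`. When `S` is a compact Hausdorff topological
semigroup, its topology (the standard one on a group of units) is the subspace topology. -/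
abbrev MaximalSubgroup {S : Type} [Semigroup S] {e : S} (he : IsIdempotentElem e) : Type :=
  (LocalMonoid he)ˣ

instance {S : Type} [Semigroup S] [TopologicalSpace S] [ContinuousMul S] [CompactSpace S]
    [T2Space S] {e : S} (he : IsIdempotentElem e) : CompactSpace (MaximalSubgroup he) :=
  Units.isClosedEmbedding_embedProduct.compactSpace

instance {S : Type} [Semigroup S] [TopologicalSpace S] [ContinuousMul S] [CompactSpace S]
    [T2Space S] [TotallyDisconnectedSpace S] {e : S} (he : IsIdempotentElem e) :
    TotallyDisconnectedSpace (MaximalSubgroup he) :=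
  ⟨isTotallyDisconnected_of_image (f := fun x : MaximalSubgroup he => (x : LocalMonoid he))
    Units.continuous_val.continuousOn Units.val_injective
    (isTotallyDisconnected_of_totallyDisconnectedSpace _)⟩

end MaximalSubgroup

/-! ### Pseudovarieties of groups and relatively free profinite groups -/

section RelativelyFree

/-- A pseudovariety of groups: a class of finite groups closed under taking subgroups,
homomorphic images and finite direct products (including the empty one). -/
structure GroupPseudovariety where
  /-- membership in the class -/
  Mem : (G : Type) → [Group G] → Prop
  finite_of_mem : ∀ (G : Type) [Group G], Mem G → Finite G
  mem_of_injective : ∀ (G H : Type) [Group G] [Group H] (f : H →* G),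
    Function.Injective f → Mem G → Mem H
  mem_of_surjective : ∀ (G H : Type) [Group G] [Group H] (f : G →* H),
    Function.Surjective f → Mem G → Mem H
  mem_unit : Mem Unit
  mem_prod : ∀ (G H : Type) [Group G] [Group H], Mem G → Mem H → Mem (G × H)

/-- A profinite group is pro-`V` if all its finite continuous quotients belong to `V`. -/
def IsProV (V : GroupPseudovariety) (G : Type) [Group G] [TopologicalSpace G]
    [IsTopologicalGroup G] [CompactSpace G] [TotallyDisconnectedSpace G] : Prop :=
  ∀ N : OpenNormalSubgroup G, V.Mem (G ⧸ N.toSubgroup)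

/-- `ι : X → G` exhibits `G` as the free pro-`V` group on the topological space `X` relative to the
subset `E`: `G` is pro-`V`, `ι` is continuous and sends `E` to `1`, and `ι` is universal for these
properties. With `X` discrete and `E = ∅`, this is the free pro-`V` group on the set `X`; with `X` a
profinite space and `E = ∅` (resp. `E = {*}`), it is the free pro-`V` group on the profinite space
`X` (resp. on the pointed profinite space `(X, *)`, which includes bases converging to `1`). -/
structure IsFreeProV (V : GroupPseudovariety) (G : Type) [Group G] [TopologicalSpace G]
    [IsTopologicalGroup G] [CompactSpace G] [TotallyDisconnectedSpace G]
    {X : Type u} [TopologicalSpace X] (E : Set X) (ι : X → G) : Prop where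
  isProV : IsProV V G
  continuous : Continuous ι
  eq_one : ∀ x ∈ E, ι x = 1
  existsUnique_lift : ∀ (H : Type) [Group H] [TopologicalSpace H] [IsTopologicalGroup H]
    [CompactSpace H] [TotallyDisconnectedSpace H], IsProV V H →
    ∀ f : X → H, Continuous f → (∀ x ∈ E, f x = 1) →
      ∃! φ : G →ₜ* H, ∀ x, φ (ι x) = f x

/-- The profinite group `G` is relatively free with respect to the pseudovariety `V`, i.e. it is a
free pro-`V` group on some (possibly pointed, possibly infinite) basis. -/
def IsRelativelyFree (V : GroupPseudovariety) (G : Type) [Group G] [TopologicalSpace G]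
    [IsTopologicalGroup G] [CompactSpace G] [TotallyDisconnectedSpace G] : Prop :=
  ∃ (X : Type u) (_ : TopologicalSpace X) (E : Set X) (ι : X → G), IsFreeProV V G E ι

end RelativelyFree

/-! ### The Prouhet-Thue-Morse substitution -/

namespace ThueMorse

/-- The two-letter alphabet `{a, b}`. -/
inductive Letter : Type
  | a
  | b

/-- The images of the letters: `a ↦ ab`, `b ↦ ba`. -/
def letterImage : Letter → FreeSemigroup Letter
  | .a => FreeSemigroup.of .a * FreeSemigroup.of .b
  | .b => FreeSemigroup.of .b * FreeSemigroup.of .a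

/-- The Prouhet-Thue-Morse substitution `τ`, an endomorphism of `{a, b}⁺`. -/
def tau : FreeSemigroup Letter →ₙ* FreeSemigroup Letter :=
  FreeSemigroup.lift letterImage

/-- `v` is a factor of `w`: `w = p v q` for possibly empty words `p` and `q`. -/
def IsFactor (v w : FreeSemigroup Letter) : Prop :=
  ∃ p q : WithOne (FreeSemigroup Letter), (w : WithOne (FreeSemigroup Letter)) = p * v * q

/-- The (nonempty) finite blocks of the Prouhet-Thue-Morse subshift: the factors of the words
`τ^k(x)`, for `x` a letter. Since `τ^k(x)` is a factor of `τ^(k+1)(y)` for some `y`, requiring `k` to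
be large would give the same set. -/
def language : Set (FreeSemigroup Letter) :=
  {w | ∃ (k : ℕ) (x : Letter), IsFactor w (tau^[k] (FreeSemigroup.of x))}

/-- The `J`-class `J(τ)` of the Prouhet-Thue-Morse subshift: the closure in the free profinite
semigroup of the set of blocks, with the blocks removed. -/
def jClass : Set (FreeProfiniteSemigroup Letter) :=
  closure (FreeProfiniteSemigroup.ofWord Letter '' language) \
    (FreeProfiniteSemigroup.ofWord Letter '' language)

end ThueMorse

/-! The obstruction lies in the continuous homomorphisms from the maximal subgroup G to ℤ/2 and ℤ/5.
There is exactly one nontrivial homomorphism χ to ℤ/2, but there are two non-proportional ones to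
ℤ/5. A relatively free group cannot behave this way.

If G is free pro-V on X and has quotients ℤ/2 and ℤ/5, both are pro-V. Given ψ : G → ℤ/5 and a
nontrivial value ψ(x) at a basis element, the indicator of the fibre of ψ over ψ(x) extends to a
nontrivial homomorphism to ℤ/2, hence to χ. So ψ is constant on the part of X where χ is nontrivial
and trivial on the rest, and any two nontrivial ψ are powers of one another
(`IsFreeProV.eq_pow_of_unique`).

Homomorphisms on G are computed through the four return words ab, abb, aab, aabb to b.a
(`exists_returnHom`). Limits of their images under τ^(2N) yield a homomorphism Θ from the free
semigroup on them to G. Its image is dense, and modulo each finite quotient Θ is invariant under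
some positive power of `returnTau`, the endomorphism induced by τ². Density uses recognizability of
τ; the J-class structure uses uniform recurrence and stability of compact semigroups.

Modulo 2 the square of `returnTau` has rank one on the abelianization, so χ is unique
(`eq_of_exists_ne_one`). Modulo 5, weights of two-letter blocks give a homomorphism fixed by
`returnTau`, and another measuring length, which `returnTau` multiplies by 4. The first kills Θ(abb)
and the second does not. -/

namespace FreeProfiniteSemigroup

/-! ### Finite quotients and closures in the free profinite semigroup -/

variable {A : Type}

/-- The projection of the free profinite semigroup to a finite quotient of `A⁺`. -/
def proj (c : FiniteCon A) : FreeProfiniteSemigroup A →ₙ* FiniteQuot c where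
  toFun x := x.1 c
  map_mul' _ _ := rfl

theorem continuous_proj (c : FiniteCon A) : Continuous (proj c) :=
  (continuous_apply c).comp continuous_subtype_val

theorem ext_proj {x y : FreeProfiniteSemigroup A} (h : ∀ c, proj c x = proj c y) : x = y :=
  Subtype.ext (funext h)

theorem proj_ofWord_eq_iff {c : FiniteCon A} {v w : FreeSemigroup A} :
    proj c (ofWord A v) = proj c (ofWord A w) ↔ c.1 v w :=
  Con.eq c.1

/-- The kernel of a homomorphism from `A⁺` to a finite semigroup. -/
def kerCon {S : Type} [Semigroup S] [Finite S] (μ : FreeSemigroup A →ₙ* S) : FiniteCon A :=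
  ⟨Con.ker μ, Finite.of_injective
    (fun q : (Con.ker μ).Quotient => q.liftOn μ fun _ _ h => h)
    (fun p q => Con.induction_on₂ p q fun _ _ h => (Con.eq _).2 h)⟩

/-- The continuous extension of a homomorphism from `A⁺` to a finite semigroup. -/
def hat {S : Type} [Semigroup S] [Finite S] (μ : FreeSemigroup A →ₙ* S) :
    FreeProfiniteSemigroup A →ₙ* S where
  toFun x := Con.liftOn (proj (kerCon μ) x : (Con.ker μ).Quotient) μ fun _ _ h => h
  map_mul' x y := by
    rw [map_mul]
    exact Con.induction_on₂ (proj (kerCon μ) x : (Con.ker μ).Quotient)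
      (proj (kerCon μ) y : (Con.ker μ).Quotient) fun v w => map_mul μ v w

@[simp] theorem hat_ofWord {S : Type} [Semigroup S] [Finite S] (μ : FreeSemigroup A →ₙ* S)
    (w : FreeSemigroup A) : hat μ (ofWord A w) = μ w := rfl

theorem hat_congr {S : Type} [Semigroup S] [Finite S] (μ : FreeSemigroup A →ₙ* S)
    {x y : FreeProfiniteSemigroup A} (h : proj (kerCon μ) x = proj (kerCon μ) y) :
    hat μ x = hat μ y :=
  congrArg (fun q : (Con.ker μ).Quotient => q.liftOn μ fun _ _ h => h) h

theorem continuous_hat {S : Type} [Semigroup S] [Finite S] [TopologicalSpace S]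
    (μ : FreeSemigroup A →ₙ* S) : Continuous (hat μ) :=
  (continuous_of_discreteTopology
    (f := fun q : FiniteQuot (kerCon μ) =>
      Con.liftOn (c := Con.ker μ) q μ fun _ _ h => h)).comp (continuous_proj _)

/-- The quotient homomorphism from `A⁺` to a finite quotient. -/
def quot (c : FiniteCon A) : FreeSemigroup A →ₙ* FiniteQuot c := (proj c).comp (ofWord A)

theorem exists_forall_proj_ofWord (s : Finset (FiniteCon A)) (x : FreeProfiniteSemigroup A) :
    ∃ w, ∀ c ∈ s, proj c (ofWord A w) = proj c x := by
  have ho : IsOpen ((s : Set (FiniteCon A)).pi fun c => {x.1 c}) :=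
    isOpen_set_pi s.finite_toSet fun c _ => isOpen_discrete _
  obtain ⟨_, h, w, rfl⟩ := mem_closure_iff.1 x.2 _ ho fun c _ => rfl
  exact ⟨w, fun c hc => h c hc⟩

/-- Finitely many finite quotients have a common refinement. -/
theorem exists_refinement (s : Finset (FiniteCon A)) :
    ∃ d : FiniteCon A, ∀ c ∈ s, ∀ x y, proj d x = proj d y → proj c x = proj c y := by
  classical
  let μ : FreeSemigroup A →ₙ* ((c : s) → FiniteQuot c.1) :=
    { toFun w c := quot c.1 w
      map_mul' v w := funext fun c => map_mul (quot c.1) v w }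
  refine ⟨kerCon μ, fun c hc x y h => ?_⟩
  obtain ⟨v, hv⟩ := exists_forall_proj_ofWord {c, kerCon μ} x
  obtain ⟨w, hw⟩ := exists_forall_proj_ofWord {c, kerCon μ} y
  rw [← hv _ (by simp), ← hw _ (by simp)] at h ⊢
  exact congrFun (proj_ofWord_eq_iff.1 h : μ v = μ w) ⟨c, hc⟩

/-- Since finitely many finite quotients have a common refinement, the fibres of single projections
already form a basis of the topology. -/
theorem mem_closure_iff_proj {Z : Set (FreeProfiniteSemigroup A)} {x : FreeProfiniteSemigroup A} :
    x ∈ closure Z ↔ ∀ c, ∃ z ∈ Z, proj c z = proj c x := by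
  refine ⟨fun h c => ?_, fun h => mem_closure_iff.2 fun U hU hx => ?_⟩
  · obtain ⟨z, hz, hz'⟩ := mem_closure_iff.1 h (proj c ⁻¹' {proj c x})
      ((isOpen_discrete _).preimage (continuous_proj c)) rfl
    exact ⟨z, hz', hz⟩
  · obtain ⟨V, hV, rfl⟩ := isOpen_induced_iff.1 hU
    obtain ⟨s, u, hu, hs⟩ := isOpen_pi_iff.1 hV x.1 hx
    obtain ⟨d, hd⟩ := exists_refinement s
    obtain ⟨z, hz, hzx⟩ := h d
    refine ⟨z, hs fun c hc => ?_, hz⟩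
    have : z.1 c = x.1 c := hd c hc z x hzx
    rw [this]
    exact (hu c hc).2

theorem exists_word_of_mem_closure {S : Type} [Semigroup S] [Finite S]
    (μ : FreeSemigroup A →ₙ* S) {K : Set (FreeSemigroup A)} {x : FreeProfiniteSemigroup A}
    (h : x ∈ closure (ofWord A '' K)) : ∃ w ∈ K, μ w = hat μ x := by
  obtain ⟨_, ⟨w, hw, rfl⟩, hz⟩ := mem_closure_iff_proj.1 h (kerCon μ)
  exact ⟨w, hw, hat_congr μ hz⟩

/-- Elements of the free profinite semigroup are separated by its finite quotients, uniformly on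
compact sets. -/
theorem exists_proj_separating {X : Type} [TopologicalSpace X] [CompactSpace X]
    {Y : Type} [TopologicalSpace Y] [DiscreteTopology Y]
    {i : X → FreeProfiniteSemigroup A} (hi : Continuous i) (hinj : Function.Injective i)
    {f : X → Y} (hf : Continuous f) :
    ∃ c, ∀ x y, proj c (i x) = proj c (i y) → f x = f y := by
  classical
  have ho : IsOpen {p : X × X | f p.1 = f p.2} :=
    (isOpen_discrete (Set.diagonal Y)).preimage (hf.prodMap hf)
  have hc : ∀ c, IsClosed {p : X × X | proj c (i p.1) = proj c (i p.2)} := fun c =>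
    isClosed_eq ((continuous_proj c).comp (hi.comp continuous_fst))
      ((continuous_proj c).comp (hi.comp continuous_snd))
  -- The pairs that no quotient separates form the diagonal, which misses the compact set where `f`
  -- differs; finitely many quotients therefore suffice.
  obtain ⟨s, hs⟩ := ho.isClosed_compl.isCompact.elim_finite_subfamily_closed _ hc (by
    ext ⟨x, y⟩
    simp only [Set.mem_inter_iff, Set.mem_compl_iff, Set.mem_ofPred_eq, Set.mem_iInter,
      Set.mem_empty_iff_false, iff_false, not_and]
    intro hne h
    exact hne (congrArg f (hinj (ext_proj h))))
  obtain ⟨d, hd⟩ := exists_refinement s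
  refine ⟨d, fun x y h => ?_⟩
  by_contra hne
  have : (x, y) ∈ (∅ : Set (X × X)) := by
    rw [← hs]
    exact ⟨hne, Set.mem_iInter₂.2 fun c hc => hd c hc _ _ h⟩
  exact this

/-! ### Factors of elements of the closure of a language -/

/-- The semigroup recording, for a word, its value in `S` and the values in `S` of its
factorizations into two nonempty words. -/
@[ext] structure Factorizations (S : Type) where
  val : S
  factors : Set (S × S)

instance {S : Type} [Finite S] : Finite (Factorizations S) :=
  Finite.of_injective (fun p => (p.val, p.factors)) fun p q h => by
    cases p; cases q; simpa using h

instance {S : Type} [Semigroup S] : Mul (Factorizations S) where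
  mul p q := ⟨p.val * q.val, {r | r = (p.val, q.val) ∨ (∃ t ∈ p.factors, r = (t.1, t.2 * q.val)) ∨
    ∃ t ∈ q.factors, r = (p.val * t.1, t.2)}⟩

theorem Factorizations.val_mul {S : Type} [Semigroup S] (p q : Factorizations S) :
    (p * q).val = p.val * q.val := rfl

instance {S : Type} [Semigroup S] : Semigroup (Factorizations S) where
  mul_assoc p q r := by
    refine Factorizations.ext (mul_assoc _ _ _) (Set.ext fun t => ?_)
    constructor
    · rintro (h | ⟨t, h | ⟨t, h, rfl⟩ | ⟨t, h, rfl⟩, rfl⟩ | ⟨t, h, rfl⟩)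
      · exact .inr (.inr ⟨_, .inl rfl, h⟩)
      · exact .inl (by rw [h, Factorizations.val_mul])
      · exact .inr (.inl ⟨t, h, by simp only [Factorizations.val_mul, mul_assoc]⟩)
      · exact .inr (.inr ⟨_, .inr (.inl ⟨t, h, rfl⟩), rfl⟩)
      · exact .inr (.inr ⟨_, .inr (.inr ⟨t, h, rfl⟩), by simp only [Factorizations.val_mul, mul_assoc]⟩)
    · rintro (h | ⟨t, h, rfl⟩ | ⟨t, h | ⟨t, h, rfl⟩ | ⟨t, h, rfl⟩, rfl⟩)
      · exact .inr (.inl ⟨_, .inl rfl, h⟩)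
      · exact .inr (.inl ⟨_, .inr (.inl ⟨t, h, rfl⟩), by simp only [Factorizations.val_mul, mul_assoc]⟩)
      · exact .inl (by rw [h, Factorizations.val_mul])
      · exact .inr (.inl ⟨_, .inr (.inr ⟨t, h, rfl⟩), rfl⟩)
      · exact .inr (.inr ⟨t, h, by simp only [Factorizations.val_mul, mul_assoc]⟩)

/-- The values of a word and of its factorizations in a semigroup. -/
def factorizations {S : Type} [Semigroup S] (μ : FreeSemigroup A →ₙ* S) :
    FreeSemigroup A →ₙ* Factorizations S :=
  FreeSemigroup.lift fun x => ⟨μ (.of x), ∅⟩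

theorem factorizations_val {S : Type} [Semigroup S] (μ : FreeSemigroup A →ₙ* S)
    (w : FreeSemigroup A) : (factorizations μ w).val = μ w := by
  induction w with
  | ih1 x => rfl
  | ih2 x w hx ih => rw [map_mul, Factorizations.val_mul, hx, ih, map_mul]

theorem exists_of_mem_factorizations {S : Type} [Semigroup S] (μ : FreeSemigroup A →ₙ* S)
    (w : FreeSemigroup A) (p : S × S) (h : p ∈ (factorizations μ w).factors) :
    ∃ u v, w = u * v ∧ μ u = p.1 ∧ μ v = p.2 := by
  induction w generalizing p with
  | ih1 x => exact h.elim
  | ih2 x w _ ih =>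
    rw [map_mul] at h
    obtain h | ⟨t, h, rfl⟩ | ⟨t, h, rfl⟩ := h
    · exact ⟨_, _, rfl, by rw [h, factorizations_val], by simp only [h, factorizations_val]⟩
    · exact h.elim
    · obtain ⟨u, v, rfl, hu, hv⟩ := ih t h
      exact ⟨.of x * u, v, (mul_assoc _ _ _).symm, by rw [map_mul, hu, factorizations_val], hv⟩

/-- The set of values of all splittings of a word is itself recognized by a finite semigroup. A word
of K close enough to `x * y` must therefore have a splitting close to `(x, y)`. This is what makes
closures of factorial languages factorial. -/
theorem exists_factorization {K : Set (FreeSemigroup A)} {x y : FreeProfiniteSemigroup A}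
    (h : x * y ∈ closure (ofWord A '' K)) (c : FiniteCon A) :
    ∃ u v, u * v ∈ K ∧ proj c (ofWord A u) = proj c x ∧ proj c (ofWord A v) = proj c y := by
  classical
  obtain ⟨w, hw, hwxy⟩ := exists_word_of_mem_closure (factorizations (quot c)) h
  have key : ∀ z, (hat (factorizations (quot c)) z).val = proj c z := fun z => by
    obtain ⟨v, hv⟩ := exists_forall_proj_ofWord {c, kerCon (factorizations (quot c))} z
    rw [← hat_congr _ (hv _ (by simp)), ← hv c (by simp), hat_ofWord, factorizations_val]
    rfl
  obtain ⟨u, v, rfl, hu, hv⟩ := exists_of_mem_factorizations (quot c) w (proj c x, proj c y) (by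
    rw [hwxy, map_mul, ← key x, ← key y]
    exact .inl rfl)
  exact ⟨u, v, hw, hu, hv⟩

theorem mem_closure_of_mul_left {K : Set (FreeSemigroup A)} {x y : FreeProfiniteSemigroup A}
    (h : x * y ∈ closure (ofWord A '' K)) :
    y ∈ closure (ofWord A '' {v | ∃ u, u * v ∈ K}) :=
  mem_closure_iff_proj.2 fun c =>
    let ⟨u, v, hK, _, hv⟩ := exists_factorization h c
    ⟨_, ⟨v, ⟨u, hK⟩, rfl⟩, hv⟩

theorem mem_closure_of_mul_right {K : Set (FreeSemigroup A)} {x y : FreeProfiniteSemigroup A}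
    (h : x * y ∈ closure (ofWord A '' K)) :
    x ∈ closure (ofWord A '' {u | ∃ v, u * v ∈ K}) :=
  mem_closure_iff_proj.2 fun c =>
    let ⟨u, v, hK, hu, _⟩ := exists_factorization h c
    ⟨_, ⟨u, ⟨v, hK⟩, rfl⟩, hu⟩

/-- The semigroup of letters and zero, in which all products are zero. -/
def Letters (A : Type) : Type := Option A

instance {A : Type} : Semigroup (Letters A) where
  mul _ _ := none
  mul_assoc _ _ _ := rfl

instance {A : Type} [Finite A] : Finite (Letters A) := inferInstanceAs (Finite (Option A))

/-- A homomorphism that separates each letter from all other words. -/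
def letters (A : Type) : FreeSemigroup A →ₙ* Letters A := FreeSemigroup.lift fun x => some x

theorem eq_of_letters_eq {a : A} {w : FreeSemigroup A} (h : letters A w = letters A (.of a)) :
    w = .of a := by
  induction w with
  | ih1 x => exact congrArg _ (Option.some.inj h)
  | ih2 x w _ _ =>
    rw [map_mul] at h
    exact nomatch h

theorem exists_refinement_letters [Finite A] (c : FiniteCon A) :
    ∃ d : FiniteCon A, (∀ x y, proj d x = proj d y → proj c x = proj c y) ∧
      ∀ w a, proj d (ofWord A w) = proj d (ofWord A (.of a)) → w = .of a := by
  classical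
  obtain ⟨d, hd⟩ := exists_refinement {c, kerCon (letters A)}
  exact ⟨d, hd c (by simp), fun w a h =>
    eq_of_letters_eq (hat_congr (letters A) (hd (kerCon (letters A)) (by simp) _ _ h))⟩

/-- An approximate splitting gives a left factor only congruent to `u`. Letters are isolated by a
finite quotient, so peeling `u` letter by letter makes the left factor exact. -/
theorem mem_closure_of_ofWord_mul [Finite A] {K : Set (FreeSemigroup A)} (u : FreeSemigroup A)
    {z : FreeProfiniteSemigroup A} (h : ofWord A u * z ∈ closure (ofWord A '' K)) :
    z ∈ closure (ofWord A '' {w | u * w ∈ K}) := by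
  induction u generalizing K z with
  | ih1 a =>
    refine mem_closure_iff_proj.2 fun c => ?_
    obtain ⟨d, hd, hl⟩ := exists_refinement_letters c
    obtain ⟨u, v, hK, hu, hv⟩ := exists_factorization h d
    obtain rfl := hl _ _ hu
    exact ⟨_, ⟨v, hK, rfl⟩, hd _ _ hv⟩
  | ih2 a u ha hu =>
    rw [map_mul, mul_assoc] at h
    simpa only [mul_assoc, Set.mem_ofPred_eq] using hu (ha h)

theorem mem_closure_of_mul_ofWord [Finite A] {K : Set (FreeSemigroup A)} (u : FreeSemigroup A)
    {z : FreeProfiniteSemigroup A} (h : z * ofWord A u ∈ closure (ofWord A '' K)) :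
    z ∈ closure (ofWord A '' {w | w * u ∈ K}) := by
  induction u generalizing K z with
  | ih1 a =>
    refine mem_closure_iff_proj.2 fun c => ?_
    obtain ⟨d, hd, hl⟩ := exists_refinement_letters c
    obtain ⟨v, u, hK, hv, hu⟩ := exists_factorization h d
    obtain rfl := hl _ _ hu
    exact ⟨_, ⟨v, hK, rfl⟩, hd _ _ hv⟩
  | ih2 a u ha hu =>
    rw [map_mul, ← mul_assoc] at h
    simpa only [mul_assoc, Set.mem_ofPred_eq] using ha (hu h)

end FreeProfiniteSemigroup

/-! ### Stability of compact semigroups -/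

section Stability

variable {S : Type} [Semigroup S] [TopologicalSpace S] [ContinuousMul S] [CompactSpace S] [T2Space S]

open MulOpposite in
/-- If `x = s x t` in a compact semigroup, then `x = p x q` for idempotents `p ∈ S¹s` and
`q ∈ tS¹`. -/
theorem exists_isIdempotentElem_of_eq {s x t : S} (h : x = s * x * t) :
    ∃ p q : S, IsIdempotentElem p ∧ IsIdempotentElem q ∧ x = p * x * q ∧
      (p = s ∨ ∃ r, p = r * s) ∧ (q = t ∨ ∃ r, q = t * r) := by
  -- A nonempty compact subsemigroup of S × Sᵒᵖ; an idempotent in it is the required pair.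
  let C : Set (S × Sᵐᵒᵖ) := {r | x = r.1 * x * unop r.2 ∧ r.1 ∈ ({s} ∪ Set.range (· * s) : Set S) ∧
      unop r.2 ∈ ({t} ∪ Set.range (t * ·) : Set S)}
  have hcl : IsClosed C := by
    refine (isClosed_eq continuous_const (by fun_prop)).inter (.inter ?_ ?_)
    · exact (isClosed_singleton.union (isCompact_range (continuous_mul_const s)).isClosed).preimage
        continuous_fst
    · exact (isClosed_singleton.union (isCompact_range (continuous_const_mul t)).isClosed).preimage
        (continuous_unop.comp continuous_snd)
  obtain ⟨⟨p, q⟩, ⟨hx, hp, hq⟩, hi⟩ := exists_idempotent_in_compact_subsemigroup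
    (fun r => continuous_mul_const r) C ⟨(s, op t), h, .inl rfl, .inl rfl⟩ hcl.isCompact (by
      rintro ⟨p, q⟩ ⟨hx, hp, hq⟩ ⟨p', q'⟩ ⟨hx', hp', hq'⟩
      refine ⟨?_, .inr ?_, .inr ?_⟩
      · calc x = p * (p' * x * unop q') * unop q := by rw [← hx', ← hx]
          _ = _ := by simp only [Prod.mk_mul_mk, unop_mul, mul_assoc]
      · obtain hp' | ⟨r, hr⟩ := hp'
        · exact ⟨p, congrArg (p * ·) hp'.symm⟩
        · exact ⟨p * r, (mul_assoc _ _ _).trans (congrArg (p * ·) hr)⟩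
      · obtain hq' | ⟨r, hr⟩ := hq'
        · exact ⟨unop q, congrArg (· * unop q) hq'.symm⟩
        · exact ⟨r * unop q, (mul_assoc _ _ _).symm.trans (congrArg (· * unop q) hr)⟩)
  have hi' := Prod.ext_iff.1 hi
  exact ⟨p, unop q, hi'.1, congrArg unop hi'.2, hx, hp.imp id fun ⟨r, hr⟩ => ⟨r, hr.symm⟩,
    hq.imp id fun ⟨r, hr⟩ => ⟨r, hr.symm⟩⟩

/-- Stability: the idempotent `q` beginning with `z * t` (or equal to it) fixes `x` on the right, so
J-equivalence of `x` and `x * z` forces R-equivalence. -/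
theorem exists_eq_mul_mul_of_eq {s x z t : S} (h : x = s * (x * z) * t) : ∃ r, x = x * z * r := by
  obtain ⟨p, q, -, hq, hx, -, hq'⟩ :=
    exists_isIdempotentElem_of_eq (s := s) (x := x) (t := z * t) (by simpa only [mul_assoc] using h)
  have hxq : x * q = x := by rw [hx, mul_assoc _ q q, hq.eq]
  obtain rfl | ⟨r, rfl⟩ := hq'
  · exact ⟨t, by rw [mul_assoc, hxq]⟩
  · exact ⟨t * r, by rw [mul_assoc, ← mul_assoc z, hxq]⟩

theorem exists_eq_mul_mul_of_eq' {s x z t : S} (h : x = s * (z * x) * t) :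
    ∃ r, x = r * (z * x) := by
  obtain ⟨p, q, hp, -, hx, hp', -⟩ :=
    exists_isIdempotentElem_of_eq (s := s * z) (x := x) (t := t)
      (by simpa only [mul_assoc] using h)
  have hpx : p * x = x := by rw [hx, mul_assoc p x q, ← mul_assoc p p, hp.eq]
  obtain rfl | ⟨r, rfl⟩ := hp'
  · exact ⟨s, by rw [← mul_assoc, hpx]⟩
  · exact ⟨r * s, by rw [← mul_assoc, mul_assoc r, hpx]⟩

end Stability

namespace ThueMorse

open Letter

/-! ### The Prouhet-Thue-Morse substitution on lists -/

/-- The list of letters of a word. -/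
def toList (w : FreeSemigroup Letter) : List Letter := w.head :: w.tail

theorem toList_mul (v w : FreeSemigroup Letter) : toList (v * w) = toList v ++ toList w := rfl

theorem toList_injective : Function.Injective toList := fun v w h => by
  obtain ⟨h, h'⟩ := List.cons.inj h
  exact FreeSemigroup.ext h h'

theorem exists_toList {l : List Letter} (h : l ≠ []) : ∃ w, toList w = l :=
  match l, h with
  | x :: l, _ => ⟨⟨x, l⟩, rfl⟩

theorem length_toList (w : FreeSemigroup Letter) : (toList w).length = w.length := rfl

theorem toList_ne_nil (w : FreeSemigroup Letter) : toList w ≠ [] := List.cons_ne_nil _ _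

/-- The other letter. -/
def swap : Letter → Letter
  | a => b
  | b => a

theorem swap_swap (x : Letter) : swap (swap x) = x := by cases x <;> rfl

theorem swap_ne (x : Letter) : swap x ≠ x := by cases x <;> exact nofun

/-- The Prouhet-Thue-Morse substitution on lists. -/
def tauList : List Letter → List Letter
  | [] => []
  | x :: l => x :: swap x :: tauList l

theorem tauList_append (l m : List Letter) : tauList (l ++ m) = tauList l ++ tauList m := by
  induction l with
  | nil => rfl
  | cons x l ih => exact congrArg (x :: swap x :: ·) ih

theorem length_tauList (l : List Letter) : (tauList l).length = 2 * l.length := by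
  induction l with
  | nil => rfl
  | cons x l ih => simp only [tauList, List.length_cons, ih]; omega

theorem tauList_injective : Function.Injective tauList := fun l => by
  induction l with
  | nil => intro m h; cases m with
    | nil => rfl
    | cons y m => exact nomatch h
  | cons x l ih => intro m h; cases m with
    | nil => exact nomatch h
    | cons y m =>
      obtain ⟨rfl, h⟩ := List.cons.inj h
      rw [ih (List.cons.inj h).2]

theorem toList_tau (w : FreeSemigroup Letter) : toList (tau w) = tauList (toList w) := by
  induction w with
  | ih1 x => cases x <;> rfl
  | ih2 x w hx hw => rw [map_mul, toList_mul, hx, hw, toList_mul, tauList_append]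

theorem toList_iterate_tau (k : ℕ) (w : FreeSemigroup Letter) :
    toList (tau^[k] w) = tauList^[k] (toList w) := by
  induction k generalizing w with
  | zero => rfl
  | succ k ih => rw [Function.iterate_succ_apply, ih, toList_tau, Function.iterate_succ_apply]

theorem iterate_tauList_append (k : ℕ) (l m : List Letter) :
    tauList^[k] (l ++ m) = tauList^[k] l ++ tauList^[k] m := by
  induction k generalizing l m with
  | zero => rfl
  | succ k ih => simp only [Function.iterate_succ_apply, tauList_append, ih]

theorem tauList_infix {l m : List Letter} (h : l <:+: m) : tauList l <:+: tauList m := by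
  obtain ⟨p, q, rfl⟩ := h
  exact ⟨tauList p, tauList q, by simp only [tauList_append]⟩

theorem isFactor_iff {v w : FreeSemigroup Letter} : IsFactor v w ↔ toList v <:+: toList w := by
  constructor
  · rintro ⟨p, q, h⟩
    obtain rfl | ⟨p, rfl⟩ := (em (p = 1)).imp id WithOne.ne_one_iff_exists.1 <;>
      obtain rfl | ⟨q, rfl⟩ := (em (q = 1)).imp id WithOne.ne_one_iff_exists.1
    · rw [one_mul, mul_one, WithOne.coe_inj] at h
      rw [h]
    · rw [one_mul, ← WithOne.coe_mul, WithOne.coe_inj] at h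
      rw [h]
      exact ⟨[], _, rfl⟩
    · rw [mul_one, ← WithOne.coe_mul, WithOne.coe_inj] at h
      rw [h]
      exact ⟨toList p, [], List.append_nil _⟩
    · rw [← WithOne.coe_mul, ← WithOne.coe_mul, WithOne.coe_inj] at h
      rw [h]
      exact ⟨toList p, toList q, rfl⟩
  · have key : ∀ l : List Letter, l = [] ∨ ∃ w, toList w = l := fun l =>
      (em (l = [])).imp id exists_toList
    rintro ⟨p, q, h⟩
    obtain rfl | ⟨p, rfl⟩ := key p <;> obtain rfl | ⟨q, rfl⟩ := key q
    · exact ⟨1, 1, by rw [one_mul, mul_one]; exact congrArg _ (toList_injective (by simpa using h.symm))⟩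
    · exact ⟨1, q, by rw [one_mul, ← WithOne.coe_mul]; exact congrArg _ (toList_injective h.symm)⟩
    · exact ⟨p, 1, by
        rw [mul_one, ← WithOne.coe_mul]
        exact congrArg _ (toList_injective (by rw [← h, List.append_nil, toList_mul]))⟩
    · exact ⟨p, q, by
        rw [← WithOne.coe_mul, ← WithOne.coe_mul]; exact congrArg _ (toList_injective h.symm)⟩

/-- The factors, as lists, of the iterates of the Prouhet-Thue-Morse substitution. -/
def langList : Set (List Letter) := {l | ∃ (k : ℕ) (x : Letter), l <:+: tauList^[k] [x]}

theorem mem_language_iff {w : FreeSemigroup Letter} : w ∈ language ↔ toList w ∈ langList := by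
  refine exists_congr fun k => exists_congr fun x => ?_
  rw [isFactor_iff, toList_iterate_tau]
  rfl

theorem mem_langList_of_infix {l m : List Letter} (hm : m ∈ langList) (h : l <:+: m) :
    l ∈ langList :=
  let ⟨k, x, hk⟩ := hm
  ⟨k, x, h.trans hk⟩

theorem tauList_mem {l : List Letter} (h : l ∈ langList) : tauList l ∈ langList :=
  let ⟨k, x, hk⟩ := h
  ⟨k + 1, x, by rw [Function.iterate_succ_apply']; exact tauList_infix hk⟩

theorem exists_infix_tauList {l : List Letter} (h : l ∈ langList) :
    ∃ m ∈ langList, l <:+: tauList m := by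
  obtain ⟨k, x, hk⟩ := h
  cases k with
  | zero => exact ⟨[x], ⟨0, x, List.infix_rfl⟩, hk.trans ⟨[], [swap x], rfl⟩⟩
  | succ k =>
    exact ⟨tauList^[k] [x], ⟨k, x, List.infix_rfl⟩, by rwa [← Function.iterate_succ_apply' tauList]⟩

/-! ### Recognizability -/

theorem exists_of_append_eq_tauList {p q l : List Letter} (h : p ++ q = tauList l)
    (hp : Even p.length) : ∃ s t, l = s ++ t ∧ p = tauList s ∧ q = tauList t := by
  induction l generalizing p with
  | nil =>
    obtain ⟨rfl, rfl⟩ := List.append_eq_nil_iff.1 h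
    exact ⟨[], [], rfl, rfl, rfl⟩
  | cons x l ih =>
    match p, h, hp with
    | [], h, _ => exact ⟨[], x :: l, rfl, rfl, h⟩
    | [_], _, hp => exact absurd hp (by simp)
    | y :: z :: p, h, hp =>
      obtain ⟨rfl, h₁⟩ := List.cons.inj h
      obtain ⟨rfl, h₂⟩ := List.cons.inj h₁
      obtain ⟨s, t, rfl, rfl, rfl⟩ := ih h₂ (by simpa [Nat.even_add_one] using hp)
      exact ⟨y :: s, t, rfl, rfl, rfl⟩

/-- The two letters of a block τ(x) differ, so the square of a letter must straddle a block
boundary. -/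
theorem odd_length_of_square {p q l : List Letter} {x : Letter} (h : p ++ x :: x :: q = tauList l) :
    Odd p.length := by
  by_contra hp
  obtain ⟨s, t, -, -, ht⟩ := exists_of_append_eq_tauList h (Nat.not_odd_iff_even.1 hp)
  match t, ht with
  | y :: t, ht =>
    obtain ⟨rfl, ht⟩ := List.cons.inj ht
    exact swap_ne _ (List.cons.inj ht).1.symm

theorem cube_notMem (x : Letter) : [x, x, x] ∉ langList := fun h => by
  obtain ⟨m, -, p, q, h⟩ := exists_infix_tauList h
  have h1 : Odd p.length := odd_length_of_square (q := x :: q) (by simpa using h)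
  have h2 : Odd (p ++ [x]).length := odd_length_of_square (q := q) (by simpa using h)
  simp [Nat.odd_add_one] at h2
  exact Nat.not_odd_iff_even.2 h2 h1

/-- The image of x·`swap x` has a square in its middle, and this square pins the position of τ(s)
relative to the block boundaries. -/
theorem even_length_of_tauList {p q s l : List Letter} {x : Letter}
    (hs : [x, swap x] <:+: s) (h : p ++ (tauList s ++ q) = tauList l) : Even p.length := by
  obtain ⟨s₁, s₂, rfl⟩ := hs
  have := odd_length_of_square (p := p ++ tauList s₁ ++ [x]) (x := swap x)
    (q := x :: tauList s₂ ++ q) (l := l) (by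
      rw [← h]; simp [tauList_append, tauList, swap_swap])
  simp only [List.length_append, length_tauList, List.length_singleton] at this
  rw [Nat.even_iff]
  rw [Nat.odd_iff] at this
  omega

theorem exists_of_tauList_append {s w : List Letter} {x : Letter} (hs : [x, swap x] <:+: s)
    (h : tauList s ++ w ++ tauList s ∈ langList) :
    ∃ w', w = tauList w' ∧ s ++ w' ++ s ∈ langList := by
  obtain ⟨m, hm, p, q, h⟩ := exists_infix_tauList h
  have h1 : p ++ (tauList s ++ (w ++ (tauList s ++ q))) = tauList m := by
    simpa only [List.append_assoc] using h
  obtain ⟨p', m, rfl, rfl, h2⟩ := exists_of_append_eq_tauList h1 (even_length_of_tauList hs h1)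
  obtain ⟨s', m, rfl, hs', h3⟩ := exists_of_append_eq_tauList h2 (by simp [length_tauList])
  obtain rfl := tauList_injective hs'
  obtain ⟨w', m, rfl, rfl, h4⟩ := exists_of_append_eq_tauList h3 (even_length_of_tauList hs h3)
  obtain ⟨s', q', rfl, hs', rfl⟩ := exists_of_append_eq_tauList h4 (by simp [length_tauList])
  obtain rfl := tauList_injective hs'
  exact ⟨w', rfl, mem_langList_of_infix hm ⟨p', q', by simp only [List.append_assoc]⟩⟩

theorem exists_infix_iterate_tauList (k : ℕ) :
    ∃ x, [x, swap x] <:+: tauList^[k] [b, a] := by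
  cases k with
  | zero => exact ⟨b, List.infix_rfl⟩
  | succ k =>
    have hk : tauList^[k] [b, a] ≠ [] := by
      change tauList^[k] (toList (.of b * .of a)) ≠ []
      rw [← toList_iterate_tau]
      exact toList_ne_nil _
    obtain ⟨x, l, hl⟩ := List.exists_cons_of_ne_nil hk
    rw [Function.iterate_succ_apply', hl]
    exact ⟨x, [], tauList l, rfl⟩

/-- Two occurrences of τ^k(ba) are synchronized with the block structure at every level, so whatever
lies between them can be desubstituted `k` times. -/
theorem exists_of_iterate_tauList_append (k : ℕ) {w : List Letter}
    (h : tauList^[k] [b, a] ++ w ++ tauList^[k] [b, a] ∈ langList) :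
    ∃ w', w = tauList^[k] w' ∧ [b, a] ++ w' ++ [b, a] ∈ langList := by
  induction k generalizing w with
  | zero => exact ⟨w, rfl, h⟩
  | succ k ih =>
    obtain ⟨x, hx⟩ := exists_infix_iterate_tauList k
    rw [Function.iterate_succ_apply'] at h
    obtain ⟨w₁, rfl, h₁⟩ := exists_of_tauList_append hx h
    obtain ⟨w₂, rfl, h₂⟩ := ih h₁
    exact ⟨w₂, (Function.iterate_succ_apply' _ _ _).symm, h₂⟩

/-! ### Uniform recurrence -/

theorem exists_eq_tauList_append {l v m : List Letter} (h : l ++ v = tauList m) :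
    ∃ m' q, l = tauList m' ++ q ∧ m' <:+: m ∧ q.length ≤ 1 := by
  obtain hl | hl := Nat.even_or_odd l.length
  · obtain ⟨s, t, rfl, rfl, -⟩ := exists_of_append_eq_tauList h hl
    exact ⟨s, [], (List.append_nil _).symm, ⟨[], t, rfl⟩, zero_le_one⟩
  · obtain rfl | ⟨l, x, rfl⟩ := List.eq_nil_or_concat' l
    · exact absurd hl (by simp)
    · obtain ⟨s, t, rfl, rfl, -⟩ := exists_of_append_eq_tauList
        ((List.append_assoc _ _ _).symm.trans h)
        (by simpa [Nat.odd_add_one] using hl)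
      exact ⟨s, [x], rfl, ⟨[], t, rfl⟩, le_rfl⟩

theorem exists_eq_append_tauList {l m : List Letter} (h : l <:+: tauList m) :
    ∃ p m' q, l = p ++ tauList m' ++ q ∧ m' <:+: m ∧ p.length ≤ 1 ∧ q.length ≤ 1 := by
  obtain ⟨u, v, h⟩ := h
  rw [List.append_assoc] at h
  obtain hu | hu := Nat.even_or_odd u.length
  · obtain ⟨s, t, rfl, -, ht⟩ := exists_of_append_eq_tauList h hu
    obtain ⟨m', q, rfl, hm, hq⟩ := exists_eq_tauList_append ht
    exact ⟨[], m', q, rfl, hm.trans ⟨s, [], List.append_nil _⟩, zero_le_one, hq⟩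
  · match l, h with
    | [], _ => exact ⟨[], [], [], rfl, List.nil_infix, zero_le_one, zero_le_one⟩
    | x :: l, h =>
      obtain ⟨s, t, rfl, -, ht⟩ := exists_of_append_eq_tauList (p := u ++ [x]) (q := l ++ v)
        (by rw [← h]; simp) (by simpa [Nat.even_add_one] using hu)
      obtain ⟨m', q, rfl, hm, hq⟩ := exists_eq_tauList_append ht
      exact ⟨[x], m', q, rfl, hm.trans ⟨s, [], List.append_nil _⟩, le_rfl, hq⟩

theorem exists_iterate_infix (k : ℕ) :
    ∃ B, ∀ l ∈ langList, B ≤ l.length → ∃ x, tauList^[k] [x] <:+: l := by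
  induction k with
  | zero =>
    refine ⟨1, fun l _ hl => ?_⟩
    obtain ⟨x, l, rfl⟩ := List.exists_cons_of_length_pos hl
    exact ⟨x, [], l, rfl⟩
  | succ k ih =>
    obtain ⟨B, hB⟩ := ih
    -- At most one letter is lost at each end, and desubstitution halves the rest.
    refine ⟨2 * B + 2, fun l hl hlen => ?_⟩
    obtain ⟨m, hm, h⟩ := exists_infix_tauList hl
    obtain ⟨p, m', q, rfl, h, hp, hq⟩ := exists_eq_append_tauList h
    simp only [List.length_append, length_tauList] at hlen
    obtain ⟨x, hx⟩ := hB m' (mem_langList_of_infix hm h) (by omega)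
    exact ⟨x, by
      rw [Function.iterate_succ_apply']
      exact (tauList_infix hx).trans ⟨p, q, rfl⟩⟩

theorem exists_forall_eq_append {v : List Letter} (hv : v ∈ langList) :
    ∃ B, ∀ l ∈ langList, B ≤ l.length → ∃ p q, p ≠ [] ∧ q ≠ [] ∧ l = p ++ v ++ q := by
  obtain ⟨k, x, p, q, hv⟩ := hv
  -- In τ³(y) both letters occur away from the ends, whereas τ²(a) = abba has a only at its ends.
  -- The margins must be nonempty, as A⁺ has no identity.
  obtain ⟨B, hB⟩ := exists_iterate_infix (k + 3)
  have key : ∀ x y : Letter, ∃ p q, p ≠ [] ∧ q ≠ [] ∧ tauList^[3] [y] = p ++ [x] ++ q := by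
    rintro (_ | _) (_ | _)
    exacts [⟨[a, b, b], [b, a, a, b], nofun, nofun, rfl⟩, ⟨[b], [a, b, a, b, b, a], nofun, nofun, rfl⟩,
      ⟨[a], [b, a, b, a, a, b], nofun, nofun, rfl⟩, ⟨[b, a, a], [a, b, b, a], nofun, nofun, rfl⟩]
  refine ⟨B, fun l hl hlen => ?_⟩
  obtain ⟨y, r, s, rfl⟩ := hB l hl hlen
  obtain ⟨p', q', hp', hq', h⟩ := key x y
  have hne : ∀ l : List Letter, l ≠ [] → tauList^[k] l ≠ [] := fun l h => by
    obtain ⟨w, rfl⟩ := exists_toList h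
    rw [← toList_iterate_tau]
    exact toList_ne_nil _
  refine ⟨r ++ tauList^[k] p' ++ p, q ++ tauList^[k] q' ++ s, by simp [hne _ hp'],
    by simp [hne _ hq'], ?_⟩
  rw [Function.iterate_add_apply, h, iterate_tauList_append, iterate_tauList_append, ← hv]
  simp only [List.append_assoc]

theorem exists_forall_eq_mul {v : FreeSemigroup Letter} (hv : v ∈ language) :
    ∃ B, ∀ w ∈ language, B ≤ w.length → ∃ p q, w = p * v * q := by
  obtain ⟨B, hB⟩ := exists_forall_eq_append (mem_language_iff.1 hv)
  refine ⟨B, fun w hw hlen => ?_⟩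
  obtain ⟨p, q, hp, hq, h⟩ := hB _ (mem_language_iff.1 hw) hlen
  obtain ⟨p, rfl⟩ := exists_toList hp
  obtain ⟨q, rfl⟩ := exists_toList hq
  exact ⟨p, q, toList_injective h⟩

theorem mem_language_of_mul_left {v w : FreeSemigroup Letter} (h : v * w ∈ language) :
    w ∈ language :=
  mem_language_iff.2 (mem_langList_of_infix (mem_language_iff.1 h)
    ⟨toList v, [], List.append_nil _⟩)

theorem mem_language_of_mul_right {v w : FreeSemigroup Letter} (h : v * w ∈ language) :
    v ∈ language :=
  mem_language_iff.2 (mem_langList_of_infix (mem_language_iff.1 h) ⟨[], toList w, rfl⟩)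

theorem tau_mem_language {w : FreeSemigroup Letter} (h : w ∈ language) : tau w ∈ language :=
  mem_language_iff.2 (toList_tau w ▸ tauList_mem (mem_language_iff.1 h))

/-! ### Return words -/

/-- The names of the four return words to the two-letter block `b.a`. -/
inductive ReturnWord : Type
  | ab
  | abb
  | aab
  | aabb

/-- The return words to `b.a`. -/
def returnWord : ReturnWord → FreeSemigroup Letter
  | .ab => .of a * .of b
  | .abb => .of a * .of b * .of b
  | .aab => .of a * .of a * .of b
  | .aabb => .of a * .of a * .of b * .of b

/-- Concatenation of return words. -/
def decode : FreeSemigroup ReturnWord →ₙ* FreeSemigroup Letter := FreeSemigroup.lift returnWord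

/-- The endomorphism induced by `τ²` on the free semigroup on the return words. -/
def returnTau : FreeSemigroup ReturnWord →ₙ* FreeSemigroup ReturnWord :=
  FreeSemigroup.lift fun
    | .ab => .of .abb * .of .ab * .of .aab
    | .abb => .of .abb * .of .ab * .of .aabb * .of .aab
    | .aab => .of .abb * .of .aabb * .of .ab * .of .aab
    | .aabb => .of .abb * .of .aabb * .of .ab * .of .aabb * .of .aab

theorem decode_returnTau (r : FreeSemigroup ReturnWord) :
    decode (returnTau r) = tau (tau (decode r)) :=
  DFunLike.congr_fun (f := decode.comp returnTau) (g := (tau.comp tau).comp decode)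
    (FreeSemigroup.hom_ext (funext fun r => by cases r <;> rfl)) r

/-- Without cubes of letters, a word from a to b is a product of words aⁱbʲ with i, j ∈ {1, 2},
which are the four return words. -/
theorem exists_decode_eq (n : ℕ) {l : List Letter} (hn : l.length ≤ n)
    (ha : ∀ x, ¬ [x, x, x] <:+: a :: l ++ [b]) :
    ∃ r, toList (decode r) = a :: l ++ [b] := by
  induction n using Nat.strong_induction_on generalizing l with | _ n ih
  have key : ∀ (r : ReturnWord) (m : List Letter), a :: l ++ [b] = toList (returnWord r) ++ (a :: m ++ [b]) →
      ∃ r, toList (decode r) = a :: l ++ [b] := by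
    intro r m h
    have hlen : m.length < n := by
      have := congrArg List.length h
      have hr : 2 ≤ (toList (returnWord r)).length := by cases r <;> decide
      simp at this
      omega
    obtain ⟨r', hr'⟩ := ih _ hlen le_rfl fun x hx => ha x (by rw [h]; exact hx.trans ⟨_, [], by simp; rfl⟩)
    exact ⟨.of r * r', by rw [h, map_mul, toList_mul, hr']; rfl⟩
  match l, ha, key with
  | [], _, _ => exact ⟨.of .ab, rfl⟩
  | [a], _, _ => exact ⟨.of .aab, rfl⟩
  | [b], _, _ => exact ⟨.of .abb, rfl⟩
  | [a, b], _, _ => exact ⟨.of .aabb, rfl⟩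
  | a :: a :: l, ha, _ => exact absurd ⟨[], l ++ [b], rfl⟩ (ha a)
  | [b, b], ha, _ => exact absurd ⟨[a], [], rfl⟩ (ha b)
  | b :: b :: b :: l, ha, _ => exact absurd ⟨[a], l ++ [b], rfl⟩ (ha b)
  | b :: a :: l, _, key => exact key .ab l rfl
  | b :: b :: a :: l, _, key => exact key .abb l rfl
  | a :: b :: a :: l, _, key => exact key .aab l rfl
  | a :: b :: b :: a :: l, _, key => exact key .aabb l rfl
  | [a, b, b], ha, _ => exact absurd ⟨[a, a], [], rfl⟩ (ha b)
  | a :: b :: b :: b :: l, ha, _ => exact absurd ⟨[a, a], l ++ [b], rfl⟩ (ha b)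

theorem iterate_tau_mul (k : ℕ) (v w : FreeSemigroup Letter) :
    tau^[k] (v * w) = tau^[k] v * tau^[k] w := iterate_map_mul tau k v w

/-- Recognizability followed by the cutting of a cube-free word into return words; this is the
source of the density of Θ. -/
theorem exists_decode_of_mem_language (k : ℕ) {w : FreeSemigroup Letter}
    (h : tau^[k] (.of b * .of a) * w * tau^[k] (.of b * .of a) ∈ language) :
    ∃ r, tau^[k] (.of a) * w * tau^[k] (.of b) = tau^[k] (decode r) := by
  rw [mem_language_iff, toList_mul, toList_mul, toList_iterate_tau] at h
  obtain ⟨l, hl, h⟩ := exists_of_iterate_tauList_append k h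
  obtain ⟨r, hr⟩ := exists_decode_eq _ le_rfl fun x hx => cube_notMem x
    (mem_langList_of_infix h (hx.trans (l₂ := a :: l ++ [b]) ⟨[b], [a], by simp⟩))
  refine ⟨r, toList_injective ?_⟩
  rw [toList_iterate_tau, hr, toList_mul, toList_mul, hl, toList_iterate_tau, toList_iterate_tau,
    ← iterate_tauList_append, ← iterate_tauList_append]
  rfl

theorem decode_returnWord_mem_language (r : ReturnWord) : decode (.of r) ∈ language := by
  have key : ∀ p q, tauList^[4] [a] = p ++ toList (returnWord r) ++ q → returnWord r ∈ language :=
    fun p q h => mem_language_iff.2 ⟨4, a, p, q, h.symm⟩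
  cases r
  · exact key [] _ rfl
  · exact key [] _ rfl
  · exact key [a, b, b, a, b] _ rfl
  · exact key [a, b, b, a, b] _ rfl

theorem aba_mem_language : .of a * .of b * .of a ∈ language :=
  mem_language_iff.2 ⟨4, a, [a, b, b], _, rfl⟩

theorem length_tau (w : FreeSemigroup Letter) : (tau w).length = 2 * w.length := by
  rw [← length_toList, toList_tau, length_tauList, length_toList]

theorem length_iterate_tau (k : ℕ) (w : FreeSemigroup Letter) :
    (tau^[k] w).length = 2 ^ k * w.length := by
  induction k with
  | zero => exact (one_mul _).symm
  | succ k ih => rw [Function.iterate_succ_apply', length_tau, ih, pow_succ', mul_assoc]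

end ThueMorse

/-- The orbit of a point of a finite set is eventually constant along the factorials. -/
theorem exists_forall_iterate_factorial {X : Type} [Finite X] (F : X → X) (x : X) :
    ∃ B : ℕ, ∀ n, B ≤ n → ∀ m, n ≤ m → F^[m.factorial] x = F^[n.factorial] x ∧
      F^[n.factorial + n.factorial] x = F^[n.factorial] x := by
  obtain ⟨i, j, hij, h⟩ := Finite.exists_ne_map_eq_of_infinite fun n => F^[n] x
  wlog hlt : i < j generalizing i j
  · exact this j i hij.symm h.symm (by omega)
  obtain ⟨p, rfl⟩ := Nat.exists_eq_add_of_lt hlt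
  have step : ∀ k l, i ≤ l → F^[l + k * (p + 1)] x = F^[l] x := by
    intro k l hl
    obtain ⟨l, rfl⟩ := Nat.exists_eq_add_of_le hl
    induction k with
    | zero => rw [zero_mul, add_zero]
    | succ k ih =>
      rw [show i + l + (k + 1) * (p + 1) = (l + k * (p + 1)) + (i + p + 1) by ring,
        Function.iterate_add_apply, ← h, ← Function.iterate_add_apply, ← ih]
      congr 1
      ring_nf
  -- The preperiod is at most `i` and `p + 1` is a period; large factorials exceed the former and
  -- are divisible by the latter.
  have hfac : ∀ n, i + p + 1 ≤ n → i ≤ n.factorial ∧ p + 1 ∣ n.factorial := fun n hn =>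
    ⟨by have := n.self_le_factorial; omega, Nat.dvd_factorial p.succ_pos (by omega)⟩
  refine ⟨i + p + 1, fun n hn m hm => ?_⟩
  obtain ⟨hi, k, hk⟩ := hfac n hn
  obtain ⟨-, l, hl⟩ := hfac m (hn.trans hm)
  constructor
  · have hle := Nat.factorial_le hm
    have hkl : k ≤ l := Nat.le_of_mul_le_mul_left (hk ▸ hl ▸ hle) p.succ_pos
    rw [← step (l - k) n.factorial hi]
    congr 1
    rw [hl, hk, mul_comm (l - k), ← mul_add, Nat.add_sub_cancel' hkl]
  · have := step k n.factorial hi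
    rwa [mul_comm, ← hk] at this

namespace ThueMorse

open FreeProfiniteSemigroup Letter Filter Topology

/-! ### Limits of iterates of the substitution -/

instance : Finite Letter :=
  Finite.of_injective (fun x : Letter => (x matches .a : Bool)) fun x y h => by
    cases x <;> cases y <;> first | rfl | exact nomatch h

theorem exists_quot_iterate_tau (c : FiniteCon Letter) :
    ∃ B : ℕ, ∀ n, B ≤ n → ∀ m, n ≤ m → ∀ w,
      quot c (tau^[2 * m.factorial] w) = quot c (tau^[2 * n.factorial] w) ∧
      quot c (tau^[2 * (n.factorial + n.factorial)] w) = quot c (tau^[2 * n.factorial] w) := by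
  -- Precomposition with τ acts on the finite set of homomorphisms from A⁺ to the quotient, each
  -- given by its values on letters.
  let F : (Letter → FiniteQuot c) → (Letter → FiniteQuot c) := fun g x =>
    FreeSemigroup.lift g (tau (.of x))
  let g₀ : Letter → FiniteQuot c := fun x => quot c (.of x)
  have hF : ∀ g w, FreeSemigroup.lift (F g) w = FreeSemigroup.lift g (tau w) := fun g w =>
    DFunLike.congr_fun (f := FreeSemigroup.lift (F g)) (g := (FreeSemigroup.lift g).comp tau)
      (FreeSemigroup.hom_ext rfl) w
  have hFn : ∀ n g w, FreeSemigroup.lift (F^[n] g) w = FreeSemigroup.lift g (tau^[n] w) := by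
    intro n
    induction n with
    | zero => exact fun _ _ => rfl
    | succ n ih =>
      intro g w
      rw [Function.iterate_succ_apply, ih, hF, Function.iterate_succ_apply']
  have hq : ∀ n w, quot c (tau^[2 * n] w) = FreeSemigroup.lift ((F^[2])^[n] g₀) w := fun n w => by
    rw [← Function.iterate_mul, hFn]
    exact DFunLike.congr_fun (f := quot c) (g := FreeSemigroup.lift g₀)
      (FreeSemigroup.hom_ext rfl) _
  obtain ⟨B, hB⟩ := exists_forall_iterate_factorial F^[2] g₀
  refine ⟨B, fun n hn m hm w => ?_⟩
  simp only [hq, hB n hn m hm, true_and]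

/-- `T` is the limit of τ^(2·n!). Factorials give convergence and idempotency modulo each finite
quotient; even exponents keep the first letter of τ^(2N)(a) and the last letter of τ^(2N)(b). -/
theorem exists_tauLim : ∃ T : FreeSemigroup Letter →ₙ* FreeProfiniteSemigroup Letter,
    ∀ c B, ∃ N, B ≤ N ∧ ∀ w, proj c (T w) = proj c (ofWord _ (tau^[2 * N] w)) ∧
      proj c (T (tau^[2 * N] w)) = proj c (T w) := by
  choose B hB using exists_quot_iterate_tau
  have hmem : ∀ w, (fun c => quot c (tau^[2 * (B c).factorial] w)) ∈
      (MulHom.srange (toFiniteQuots Letter)).topologicalClosure := fun w => by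
    refine mem_closure_of_tendsto (b := atTop)
      (f := fun n : ℕ => toFiniteQuots Letter (tau^[2 * n.factorial] w)) ?_
      (Eventually.of_forall fun n => ⟨_, rfl⟩)
    refine tendsto_pi_nhds.2 fun c => tendsto_nhds_of_eventually_eq ?_
    filter_upwards [eventually_ge_atTop (B c)] with n hn
    exact (hB c _ le_rfl n hn w).1
  let T : FreeSemigroup Letter →ₙ* FreeProfiniteSemigroup Letter :=
    { toFun w := ⟨_, hmem w⟩
      map_mul' v w := ext_proj fun c =>
        (congrArg (quot c) (iterate_tau_mul _ v w)).trans (map_mul (quot c) _ _) }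
  have hT : ∀ c w, proj c (T w) = quot c (tau^[2 * (B c).factorial] w) := fun _ _ => rfl
  refine ⟨T, fun c m => ?_⟩
  have hle : B c ≤ max (B c) m := le_max_left _ _
  refine ⟨(max (B c) m).factorial, (le_max_right _ _).trans (Nat.self_le_factorial _), fun w => ?_⟩
  have key : ∀ w, proj c (T w) = quot c (tau^[2 * (max (B c) m).factorial] w) := fun w => by
    rw [hT, (hB c _ le_rfl _ hle w).1]
  refine ⟨key w, ?_⟩
  rw [key, key, ← Function.iterate_add_apply, ← mul_add]
  exact (hB c _ hle _ le_rfl w).2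

/-! ### Limits of arbitrarily long blocks -/

/-- The limits of blocks of lengths tending to infinity. -/
def infiniteBlocks : Set (FreeProfiniteSemigroup Letter) :=
  {x | ∀ n, x ∈ closure (ofWord Letter '' {w ∈ language | n ≤ w.length})}

theorem mem_closure_of_mem_infiniteBlocks {x : FreeProfiniteSemigroup Letter}
    (h : x ∈ infiniteBlocks) : x ∈ closure (ofWord Letter '' language) :=
  closure_mono (Set.image_mono fun _ hw => hw.1) (h 0)

theorem closure_language_of_mul_left {x y : FreeProfiniteSemigroup Letter}
    (h : x * y ∈ closure (ofWord Letter '' language)) : y ∈ closure (ofWord Letter '' language) :=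
  closure_mono (Set.image_mono fun w (hw : ∃ u, u * w ∈ language) =>
    mem_language_of_mul_left hw.choose_spec)
    (mem_closure_of_mul_left h)

theorem closure_language_of_mul_right {x y : FreeProfiniteSemigroup Letter}
    (h : x * y ∈ closure (ofWord Letter '' language)) : x ∈ closure (ofWord Letter '' language) :=
  closure_mono (Set.image_mono fun w (hw : ∃ v, w * v ∈ language) =>
    mem_language_of_mul_right hw.choose_spec)
    (mem_closure_of_mul_right h)

/-- Writing e as a product of arbitrarily many copies of itself, each copy is approximated by a
nonempty word. -/
theorem exists_long_of_isIdempotentElem {A : Type} {e : FreeProfiniteSemigroup A}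
    (he : IsIdempotentElem e) (n : ℕ) (c : FiniteCon A) {K : Set (FreeSemigroup A)}
    (h : e ∈ closure (ofWord A '' K)) :
    ∃ w ∈ K, n ≤ w.length ∧ proj c (ofWord A w) = proj c e := by
  classical
  induction n generalizing K with
  | zero =>
    obtain ⟨_, ⟨w, hw, rfl⟩, hwe⟩ := mem_closure_iff_proj.1 h c
    exact ⟨w, hw, Nat.zero_le _, hwe⟩
  | succ n ih =>
    obtain ⟨v, ⟨u, hu, huv⟩, hn, hv⟩ := ih (K := {v | ∃ u, proj c (ofWord A u) = proj c e ∧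
        u * v ∈ K}) (by
      refine mem_closure_iff_proj.2 fun d => ?_
      obtain ⟨d', hd⟩ := exists_refinement {c, d}
      rw [← he.eq] at h
      obtain ⟨u, v, hK, hu, hv⟩ := exists_factorization h d'
      exact ⟨_, ⟨v, ⟨u, hd c (by simp) _ _ hu, hK⟩, rfl⟩, hd d (by simp) _ _ hv⟩)
    refine ⟨u * v, huv, ?_, by rw [map_mul, map_mul, hu, hv, ← map_mul, he.eq]⟩
    have : 1 ≤ u.length := Nat.succ_pos _
    rw [FreeSemigroup.length_mul]
    omega

theorem ofWord_not_isIdempotentElem {A : Type} (w : FreeSemigroup A) :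
    ¬ IsIdempotentElem (ofWord A w) := fun h => by
  obtain ⟨v, rfl, hv, -⟩ := exists_long_of_isIdempotentElem h (w.length + 1)
    (kerCon (⟨fun _ => (), fun _ _ => rfl⟩ : FreeSemigroup A →ₙ* Unit)) (K := {w})
    (subset_closure ⟨w, rfl, rfl⟩)
  omega

theorem isIdempotentElem_mem_infiniteBlocks {e : FreeProfiniteSemigroup Letter}
    (he : IsIdempotentElem e) (h : e ∈ closure (ofWord Letter '' language)) :
    e ∈ infiniteBlocks := fun n => mem_closure_iff_proj.2 fun c =>
  let ⟨w, hw, hn, hwe⟩ := exists_long_of_isIdempotentElem he n c h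
  ⟨_, ⟨w, ⟨hw, hn⟩, rfl⟩, hwe⟩

/-- Uniform recurrence makes every long block a multiple of a given block, and compactness carries
this to limits. Consequently all of `infiniteBlocks` lies in one J-class. -/
theorem exists_eq_mul_mul {x y : FreeProfiniteSemigroup Letter} (hx : x ∈ infiniteBlocks)
    (hy : y ∈ closure (ofWord Letter '' language)) : ∃ p q, x = p * y * q := by
  have hcl : ∀ y, IsCompact (Set.range fun r : FreeProfiniteSemigroup Letter ×
      FreeProfiniteSemigroup Letter => r.1 * y * r.2) := fun y => isCompact_range (by fun_prop)
  have hcl' : IsClosed {y | ∃ p q, x = p * y * q} := by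
    have : IsCompact ((fun r : FreeProfiniteSemigroup Letter × FreeProfiniteSemigroup Letter ×
        FreeProfiniteSemigroup Letter => r.2.1) '' {r | x = r.1 * r.2.1 * r.2.2}) :=
      (isClosed_eq (by fun_prop) (by fun_prop)).isCompact.image (by fun_prop)
    convert this.isClosed
    ext y
    exact ⟨fun ⟨p, q, h⟩ => ⟨(p, y, q), h, rfl⟩, fun ⟨⟨p, _, q⟩, h, hy⟩ => ⟨p, q, hy ▸ h⟩⟩
  refine closure_minimal ?_ hcl' hy
  rintro _ ⟨v, hv, rfl⟩
  obtain ⟨B, hB⟩ := exists_forall_eq_mul hv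
  obtain ⟨⟨p, q⟩, h⟩ := closure_minimal (by
    rintro _ ⟨w, ⟨hw, hlen⟩, rfl⟩
    obtain ⟨p, q, rfl⟩ := hB w hw hlen
    exact ⟨(ofWord _ p, ofWord _ q), by simp only [map_mul]⟩) (hcl (ofWord _ v)).isClosed (hx B)
  exact ⟨p, q, h.symm⟩

end ThueMorse

/-! ### Elements of a maximal subgroup -/

section MaximalSubgroup

variable {S : Type} [Semigroup S] {e : S} {he : IsIdempotentElem e}

namespace MaximalSubgroup

/-- The underlying element of an element of a maximal subgroup. -/
def elem (g : MaximalSubgroup he) : S := (show Subsemigroup.corner e from g.1).1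

theorem elem_injective : Function.Injective (elem (he := he)) := fun _ _ h =>
  Units.ext (Subtype.ext h)

theorem elem_mul (g h : MaximalSubgroup he) : elem (g * h) = elem g * elem h := rfl

theorem elem_one : elem (1 : MaximalSubgroup he) = e := rfl

theorem mul_elem (g : MaximalSubgroup he) : e * elem g = elem g :=
  congrArg elem (one_mul g)

theorem elem_mul_self (g : MaximalSubgroup he) : elem g * e = elem g :=
  congrArg elem (mul_one g)

theorem continuous_elem [TopologicalSpace S] [ContinuousMul S] :
    Continuous (elem (he := he)) :=
  (continuous_subtype_val (p := (· ∈ Subsemigroup.corner e))).comp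
    (Units.continuous_val (M := LocalMonoid he))

/-- The element of a maximal subgroup with given inverse. -/
def mk' {x y : S} (hx : e * x = x ∧ x * e = x) (hy : e * y = y ∧ y * e = y) (hxy : x * y = e)
    (hyx : y * x = e) : MaximalSubgroup he where
  val := ⟨x, (Subsemigroup.mem_corner_iff he).2 hx⟩
  inv := ⟨y, (Subsemigroup.mem_corner_iff he).2 hy⟩
  val_inv := Subtype.ext hxy
  inv_val := Subtype.ext hyx

theorem exists_elem_eq {x y : S} (hx : e * x = x ∧ x * e = x) (hy : e * y = y ∧ y * e = y)
    (hxy : x * y = e) (hyx : y * x = e) : ∃ g : MaximalSubgroup he, elem g = x :=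
  ⟨mk' hx hy hxy hyx, rfl⟩

end MaximalSubgroup

end MaximalSubgroup

/-! ### Idempotents of the J-class and the return homomorphism -/

namespace ThueMorse

open FreeProfiniteSemigroup Letter MaximalSubgroup

section Limits

variable {T : FreeSemigroup Letter →ₙ* FreeProfiniteSemigroup Letter}
  (hT : ∀ c B, ∃ N, B ≤ N ∧ ∀ w, proj c (T w) = proj c (ofWord _ (tau^[2 * N] w)) ∧
      proj c (T (tau^[2 * N] w)) = proj c (T w))

include hT

theorem tauLim_mem_closure (B : ℕ) (w : FreeSemigroup Letter) :
    T w ∈ closure (ofWord Letter '' {v | ∃ N, B ≤ N ∧ v = tau^[2 * N] w}) :=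
  mem_closure_iff_proj.2 fun c =>
    let ⟨N, hN, h⟩ := hT c B
    ⟨_, ⟨_, ⟨N, hN, rfl⟩, rfl⟩, (h w).1.symm⟩

theorem tauLim_mem_infiniteBlocks {w : FreeSemigroup Letter} (hw : w ∈ language) :
    T w ∈ infiniteBlocks := fun n => by
  refine closure_mono (Set.image_mono ?_) (tauLim_mem_closure hT n w)
  rintro _ ⟨N, hN, rfl⟩
  refine ⟨?_, ?_⟩
  · generalize 2 * N = k
    induction k with
    | zero => exact hw
    | succ k ih => rw [Function.iterate_succ_apply']; exact tau_mem_language ih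
  · rw [length_iterate_tau]
    have h1 : 1 ≤ w.length := Nat.succ_pos _
    have h2 : 2 * N < 2 ^ (2 * N) := Nat.lt_two_pow_self
    nlinarith

theorem exists_tauLim_eq_mul (N : ℕ) :
    ∃ z, T (.of a) = ofWord _ (tau^[2 * N] (.of a)) * z := by
  have key : ∀ k, ∃ w, tau^[2 * (k + 1)] (.of a) = .of a * w := by
    intro k
    induction k with
    | zero => exact ⟨.of b * (.of b * .of a), rfl⟩
    | succ k ih =>
      obtain ⟨w, hw⟩ := ih
      exact ⟨.of b * (.of b * .of a) * tau (tau w), by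
        rw [mul_add, add_comm, Function.iterate_add_apply, hw]
        simp only [Nat.mul_one, Function.iterate_succ_apply, Function.iterate_zero_apply, map_mul]
        rfl⟩
  have hcl := (isCompact_range (continuous_const_mul (ofWord _ (tau^[2 * N] (.of a))))).isClosed
  obtain ⟨z, hz⟩ := closure_minimal (by
    rintro _ ⟨_, ⟨M, hM, rfl⟩, rfl⟩
    obtain ⟨k, rfl⟩ := Nat.exists_eq_add_of_lt hM
    obtain ⟨w, hw⟩ := key k
    refine ⟨ofWord _ (tau^[2 * N] w), ?_⟩
    rw [add_assoc, mul_add, Function.iterate_add_apply, hw, iterate_tau_mul, map_mul]) hcl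
    (tauLim_mem_closure hT (N + 1) (.of a))
  exact ⟨z, hz.symm⟩

theorem exists_tauLim_eq_mul' (N : ℕ) :
    ∃ z, T (.of b) = z * ofWord _ (tau^[2 * N] (.of b)) := by
  have key : ∀ k, ∃ w, tau^[2 * (k + 1)] (.of b) = w * .of b := by
    intro k
    induction k with
    | zero => exact ⟨.of b * .of a * .of a, rfl⟩
    | succ k ih =>
      obtain ⟨w, hw⟩ := ih
      exact ⟨tau (tau w) * (.of b * .of a * .of a), by
        rw [mul_add, add_comm, Function.iterate_add_apply, hw]
        simp only [Nat.mul_one, Function.iterate_succ_apply, Function.iterate_zero_apply, map_mul,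
          mul_assoc]
        rfl⟩
  have hcl := (isCompact_range (continuous_mul_const (ofWord _ (tau^[2 * N] (.of b))))).isClosed
  obtain ⟨z, hz⟩ := closure_minimal (by
    rintro _ ⟨_, ⟨M, hM, rfl⟩, rfl⟩
    obtain ⟨k, rfl⟩ := Nat.exists_eq_add_of_lt hM
    obtain ⟨w, hw⟩ := key k
    refine ⟨ofWord _ (tau^[2 * N] w), ?_⟩
    rw [add_assoc, mul_add, Function.iterate_add_apply, hw, iterate_tau_mul, map_mul]) hcl
    (tauLim_mem_closure hT (N + 1) (.of b))
  exact ⟨z, hz.symm⟩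

end Limits

theorem ba_mem_language : .of b * .of a ∈ language :=
  mem_language_of_mul_left (v := .of a) aba_mem_language

theorem mem_language_of (x : Letter) : .of x ∈ language := by
  cases x
  · exact mem_language_of_mul_left ba_mem_language
  · exact mem_language_of_mul_right ba_mem_language

/-- By recurrence T(a) is a multiple of T(aba), so stability gives T(a) = T(ab)·T(a)·r; iterating
this produces an idempotent prefix of T(a). -/
theorem exists_isIdempotentElem_mem_jClass : ∃ e ∈ jClass, IsIdempotentElem e := by
  obtain ⟨T, hT⟩ := exists_tauLim
  obtain ⟨p, q, h⟩ := exists_eq_mul_mul (tauLim_mem_infiniteBlocks hT (mem_language_of a))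
    (mem_closure_of_mem_infiniteBlocks (tauLim_mem_infiniteBlocks hT aba_mem_language))
  rw [map_mul, map_mul] at h
  obtain ⟨r, hr⟩ := exists_eq_mul_mul_of_eq (x := T (.of a)) (s := p) (z := T (.of b) * T (.of a))
    (t := q) (by simpa only [mul_assoc] using h)
  obtain ⟨e, f, he, -, hx, -⟩ := exists_isIdempotentElem_of_eq (s := T (.of a) * T (.of b))
    (x := T (.of a)) (t := r) (by simpa only [mul_assoc] using hr)
  have hmem := mem_closure_of_mem_infiniteBlocks (tauLim_mem_infiniteBlocks hT (mem_language_of a))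
  rw [hx, mul_assoc] at hmem
  refine ⟨e, ⟨closure_language_of_mul_right hmem, ?_⟩, he⟩
  rintro ⟨w, -, rfl⟩
  exact ofWord_not_isIdempotentElem w he

theorem elem_mem_closure {e : FreeProfiniteSemigroup Letter} {he : IsIdempotentElem e}
    (h : e ∈ closure (ofWord Letter '' language)) (g : MaximalSubgroup he) :
    elem g ∈ closure (ofWord Letter '' language) :=
  closure_language_of_mul_right (y := elem g⁻¹) (by rwa [← elem_mul, mul_inv_cancel, elem_one])

/-- The factorization e = pT(b)T(a)q gives an idempotent f, J-equivalent to e, lying in T(a)S ∩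
ST(b). Images under T of return words begin with T(a) and end with T(b), hence lie in the maximal
subgroup at f, which is then transported to e. Separating the letters b and a in the middle of e
prepares the count of two-letter blocks. -/
theorem exists_returnHom {e : FreeProfiniteSemigroup Letter} (he : IsIdempotentElem e)
    (hJ : e ∈ jClass) :
    ∃ (x y : FreeProfiniteSemigroup Letter) (Θ : FreeSemigroup ReturnWord →ₙ* MaximalSubgroup he),
      x * ofWord _ (.of b) * (ofWord _ (.of a) * y) = e ∧
      (∀ c (g : MaximalSubgroup he), ∃ r, proj c (elem (Θ r)) = proj c (elem g)) ∧
      ∀ c, ∃ N, 1 ≤ N ∧ ∀ r,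
        proj c (elem (Θ r)) = proj c (x * ofWord _ (.of b) *
          ofWord _ (decode (returnTau^[N] r)) * (ofWord _ (.of a) * y)) ∧
        proj c (elem (Θ (returnTau^[N] r))) = proj c (elem (Θ r)) := by
  obtain ⟨T, hT⟩ := exists_tauLim
  have hdec : ∀ N r, decode (returnTau^[N] r) = tau^[2 * N] (decode r) := by
    intro N
    induction N with
    | zero => exact fun r => rfl
    | succ N ih =>
      intro r
      rw [Function.iterate_succ_apply, ih, decode_returnTau, mul_add, Function.iterate_add_apply]
      rfl
  have heI := isIdempotentElem_mem_infiniteBlocks he hJ.1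
  obtain ⟨p, q, hpq⟩ := exists_eq_mul_mul heI
    (mem_closure_of_mem_infiniteBlocks (tauLim_mem_infiniteBlocks hT ba_mem_language))
  obtain ⟨α, hα⟩ : ∃ α, α = T (.of a) := ⟨_, rfl⟩
  obtain ⟨β, hβ⟩ : ∃ β, β = T (.of b) := ⟨_, rfl⟩
  rw [map_mul, ← hα, ← hβ] at hpq
  obtain ⟨x, hx⟩ : ∃ x, x = e * p * β := ⟨_, rfl⟩
  obtain ⟨y, hy⟩ : ∃ y, y = α * (q * e) := ⟨_, rfl⟩
  obtain ⟨f, hf⟩ : ∃ f, f = y * x := ⟨_, rfl⟩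
  have hex : e * x = x := by rw [hx, mul_assoc e p, ← mul_assoc, he.eq]
  have hye : y * e = y := by rw [hy, mul_assoc, mul_assoc, he.eq]
  have hxy : x * y = e := by
    calc x * y = e * (p * (β * α) * q) * e := by rw [hx, hy]; simp only [mul_assoc]
      _ = e := by rw [← hpq, he.eq, he.eq]
  have hff : f * f = f := by
    calc f * f = y * (x * y) * x := by rw [hf]; simp only [mul_assoc]
      _ = f := by rw [hxy, hye, hf]
  have hxf : x * f = x := by rw [hf, ← mul_assoc, hxy, hex]
  have hfy : f * y = y := by rw [hf, mul_assoc, hxy, hye]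
  have hfc : f ∈ closure (ofWord Letter '' language) := by
    refine closure_language_of_mul_left (x := x) (closure_language_of_mul_right (y := y) ?_)
    rw [hxf, hxy]
    exact hJ.1
  -- f is a right multiple of α and a left multiple of β; stability upgrades this to fα = α and βf =
  -- β.
  have hfI := isIdempotentElem_mem_infiniteBlocks hff hfc
  have hfα : f * α = α := by
    obtain ⟨s, t, h⟩ := exists_eq_mul_mul (tauLim_mem_infiniteBlocks hT (mem_language_of a)) hfc
    rw [← hα] at h
    have hfα' : f = α * (q * e * x) := by rw [hf, hy]; simp only [mul_assoc]
    obtain ⟨r, hr⟩ := exists_eq_mul_mul_of_eq (hfα' ▸ h)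
    rw [hr, ← hfα', ← mul_assoc, hff]
  have hβf : β * f = β := by
    obtain ⟨s, t, h⟩ := exists_eq_mul_mul (tauLim_mem_infiniteBlocks hT (mem_language_of b)) hfc
    rw [← hβ] at h
    have hfβ : f = y * e * p * β := by rw [hf, hx]; simp only [mul_assoc]
    obtain ⟨r, hr⟩ := exists_eq_mul_mul_of_eq' (hfβ ▸ h)
    rw [hr, ← hfβ, mul_assoc, hff]
  have hfT : ∀ r, f * T (decode (.of r)) = T (decode (.of r)) := by
    intro r
    cases r <;>
      simp only [decode, FreeSemigroup.lift_of, returnWord, map_mul, ← hα, ← mul_assoc, hfα]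
  have hTf : ∀ r, T (decode (.of r)) * f = T (decode (.of r)) := by
    intro r
    cases r <;>
      simp only [decode, FreeSemigroup.lift_of, returnWord, map_mul, ← hβ, mul_assoc, hβf]
  -- An element of fSf that is J-equivalent to f is invertible there, again by stability; g ↦ xgy is
  -- the transport from f to e.
  have hunit : ∀ r, ∃ g : MaximalSubgroup he, elem g = x * T (decode (.of r)) * y := by
    intro r
    obtain ⟨s, t, h⟩ := exists_eq_mul_mul hfI (mem_closure_of_mem_infiniteBlocks
      (tauLim_mem_infiniteBlocks hT (decode_returnWord_mem_language r)))
    obtain ⟨k, hk⟩ := exists_eq_mul_mul_of_eq (by rwa [← hfT] at h)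
    obtain ⟨k', hk'⟩ := exists_eq_mul_mul_of_eq' (by rwa [← hTf] at h)
    rw [hfT] at hk
    rw [hTf] at hk'
    obtain ⟨t, ht⟩ : ∃ t, t = T (decode (.of r)) := ⟨_, rfl⟩
    have hft := hfT r
    have htf := hTf r
    rw [← ht] at hk hk' hft htf ⊢
    have h₁ : t * (f * k * f) = f := by
      calc t * (f * k * f) = t * f * k * f := by simp only [mul_assoc]
        _ = f := by rw [htf, ← hk, hff]
    have h₂ : f * k * f * t = f := by
      calc f * k * f * t = f * k * t := by rw [mul_assoc _ f t, hft]
        _ = k' * (t * k) * t := by nth_rw 1 [hk']; simp only [mul_assoc]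
        _ = f := by rw [← hk, mul_assoc, hft, ← hk']
    refine exists_elem_eq (y := x * (f * k * f) * y) ?_ ?_ ?_ ?_
    · exact ⟨by simp only [← mul_assoc, hex], by simp only [mul_assoc, hye]⟩
    · exact ⟨by simp only [← mul_assoc, hex], by simp only [mul_assoc, hye]⟩
    · calc _ = x * (t * (y * x)) * (f * k * f) * y := by simp only [mul_assoc]
        _ = x * (t * (f * k * f)) * y := by rw [← hf, htf]; simp only [mul_assoc]
        _ = e := by rw [h₁, hxf, hxy]
    · calc _ = x * (f * k * f) * ((y * x) * t) * y := by simp only [mul_assoc]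
        _ = x * (f * k * f * t) * y := by rw [← hf, hft]; simp only [mul_assoc]
        _ = e := by rw [h₂, hxf, hxy]
  choose θ hθ using hunit
  have hΘ : ∀ r, elem (FreeSemigroup.lift θ r) = x * T (decode r) * y := by
    intro r
    induction r with
    | ih1 r => exact hθ r
    | ih2 r s h₁ h₂ =>
      rw [map_mul, elem_mul, h₁, h₂, map_mul, map_mul]
      calc _ = x * T (decode (.of r)) * (y * x) * (T (decode s) * y) := by simp only [mul_assoc]
        _ = _ := by rw [← hf, mul_assoc x, hTf]; simp only [mul_assoc]
  obtain ⟨β', hβ'⟩ := exists_tauLim_eq_mul' hT 0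
  obtain ⟨α', hα'⟩ := exists_tauLim_eq_mul hT 0
  rw [← hβ] at hβ'
  rw [← hα] at hα'
  have hx' : x = e * p * β' * ofWord _ (.of b) := by rw [hx, hβ', mul_assoc _ β']; rfl
  have hy' : y = ofWord _ (.of a) * (α' * (q * e)) := by rw [hy, hα', mul_assoc]; rfl
  refine ⟨e * p * β', α' * (q * e), FreeSemigroup.lift θ, by rw [← hx', ← hy', hxy], ?_, ?_⟩
  · intro c g
    obtain ⟨N, -, hN⟩ := hT c 0
    obtain ⟨α₁, hα₁⟩ := exists_tauLim_eq_mul hT N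
    obtain ⟨β₁, hβ₁⟩ := exists_tauLim_eq_mul' hT N
    rw [← hα] at hα₁
    rw [← hβ] at hβ₁
    obtain ⟨u, hu⟩ : ∃ u, u = tau^[2 * N] (.of b * .of a) := ⟨_, rfl⟩
    have hba : β * α = β₁ * ofWord _ u * α₁ := by
      rw [hu, iterate_tau_mul, map_mul, hα₁, hβ₁]
      simp only [mul_assoc]
    -- Both identities around g are expanded to expose u = τ^(2N)(ba) on either side, so that the
    -- approximating words between the two copies of u desubstitute into return words.
    have hg : p * β₁ * (ofWord _ u * (α₁ * (q * elem g * p) * β₁) * ofWord _ u) * (α₁ * q) =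
        elem g := by
      calc _ = p * (β₁ * ofWord _ u * α₁) * q * elem g * (p * (β₁ * ofWord _ u * α₁) * q) := by
            simp only [mul_assoc]
        _ = elem g := by rw [← hba, ← hpq, mul_elem, elem_mul_self]
    have hmem := elem_mem_closure hJ.1 g
    rw [← hg] at hmem
    have hz := mem_closure_of_ofWord_mul _ (mem_closure_of_mul_ofWord _
      (closure_language_of_mul_left (closure_language_of_mul_right hmem)))
    obtain ⟨_, ⟨w, hw, rfl⟩, hwc⟩ := mem_closure_iff_proj.1 hz c
    obtain ⟨r, hr⟩ := exists_decode_of_mem_language (2 * N) (w := w) (by rw [← hu]; exact hw)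
    refine ⟨r, ?_⟩
    have hTr : proj c (T (decode r)) = proj c (α * (q * elem g * p) * β) := by
      rw [(hN _).1, ← hr]
      simp only [map_mul] at hwc ⊢
      rw [hwc, hα₁, hβ₁]
      simp only [map_mul, mul_assoc]
    rw [hΘ, map_mul, map_mul, hTr, ← map_mul, ← map_mul]
    congr 1
    calc _ = e * (p * (β * α) * q) * elem g * (p * (β * α) * q) * e := by
          rw [hx, hy]; simp only [mul_assoc]
      _ = elem g := by rw [← hpq, he.eq, mul_elem, elem_mul_self, elem_mul_self]
  · intro c
    obtain ⟨N, hN1, hN⟩ := hT c 1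
    refine ⟨N, hN1, fun r => ?_⟩
    rw [hΘ, hΘ, hdec, ← hx', ← hy']
    constructor
    · simp only [map_mul, (hN _).1]
    · simp only [map_mul, (hN _).2]

end ThueMorse

/-! ### Weights of two-letter blocks -/

namespace ThueMorse

open FreeProfiniteSemigroup Letter MaximalSubgroup

/-- The semigroup of triples of a first letter, a sum of weights of two-letter blocks, and a last
letter: a Rees matrix semigroup over `ℤ/p` with sandwich matrix `c`. -/
@[ext] structure BlockSum {p : ℕ} (c : Letter → Letter → ZMod p) : Type where
  first : Letter
  sum : ZMod p
  last : Letter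

variable {p : ℕ} (c : Letter → Letter → ZMod p)

instance : Semigroup (BlockSum c) where
  mul s t := ⟨s.first, s.sum + c s.last t.first + t.sum, t.last⟩
  mul_assoc s t u := BlockSum.ext rfl (by simp only [HMul.hMul, Mul.mul]; ring) rfl

instance [NeZero p] : Finite (BlockSum c) :=
  Finite.of_injective (fun s => (s.first, s.sum, s.last)) fun s t h => by
    cases s; cases t; simpa using h

variable {c}

@[simp] theorem BlockSum.first_mul (s t : BlockSum c) : (s * t).first = s.first := rfl

@[simp] theorem BlockSum.last_mul (s t : BlockSum c) : (s * t).last = t.last := rfl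

@[simp] theorem BlockSum.sum_mul (s t : BlockSum c) :
    (s * t).sum = s.sum + c s.last t.first + t.sum := rfl

variable (c)

/-- The sum of the weights of the two-letter factors of a word. -/
def blockSum : FreeSemigroup Letter →ₙ* BlockSum c := FreeSemigroup.lift fun x => ⟨x, 0, x⟩

/-- The sum of the weights of the two-letter factors of a product of return words, read
cyclically. -/
def cyclicSum : FreeSemigroup ReturnWord →ₙ* Multiplicative (ZMod p) :=
  FreeSemigroup.lift fun r => .ofAdd ((blockSum c (returnWord r)).sum + c b a)

theorem blockSum_decode (r : FreeSemigroup ReturnWord) :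
    (blockSum c (decode r)).first = a ∧ (blockSum c (decode r)).last = b ∧
      (blockSum c (decode r)).sum + c b a = (cyclicSum c r).toAdd := by
  induction r with
  | ih1 r => cases r <;> exact ⟨rfl, rfl, rfl⟩
  | ih2 r s hr hs =>
    obtain ⟨hr₁, hr₂, hr₃⟩ := hr
    obtain ⟨hs₁, hs₂, hs₃⟩ := hs
    rw [map_mul, map_mul, map_mul, toAdd_mul, ← hr₃, ← hs₃]
    refine ⟨hr₁, hs₂, ?_⟩
    rw [BlockSum.sum_mul, hr₂, hs₁]
    ring

variable [NeZero p] {e : FreeProfiniteSemigroup Letter} (he : IsIdempotentElem e)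

/-- The homomorphism from a maximal subgroup to `ℤ/p` given by weights of two-letter blocks. -/
def weightHom : MaximalSubgroup he →ₜ* Multiplicative (ZMod p) where
  -- Every g has the first and last letters of e, so each product creates the same junction weight;
  -- adding it once makes the sum multiplicative.
  toMonoidHom := MonoidHom.mk' (fun g => .ofAdd ((hat (blockSum c) (elem g)).sum +
      c (hat (blockSum c) e).last (hat (blockSum c) e).first)) fun g h => by
    have hg : (hat (blockSum c) (elem g)).last = (hat (blockSum c) e).last := by
      rw [← elem_mul_self g, map_mul, BlockSum.last_mul]
    have hh : (hat (blockSum c) (elem h)).first = (hat (blockSum c) e).first := by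
      rw [← mul_elem h, map_mul, BlockSum.first_mul]
    rw [← ofAdd_add, elem_mul, map_mul, BlockSum.sum_mul, hg, hh]
    congr 1
    ring
  continuous_toFun := by
    let _ : TopologicalSpace (BlockSum c) := ⊥
    have : DiscreteTopology (BlockSum c) := ⟨rfl⟩
    exact (continuous_of_discreteTopology (f := fun s : BlockSum c =>
      Multiplicative.ofAdd (s.sum + c (hat (blockSum c) e).last (hat (blockSum c) e).first))).comp
        ((continuous_hat (blockSum c)).comp continuous_elem)

theorem weightHom_apply (g : MaximalSubgroup he) :
    weightHom c he g = .ofAdd ((hat (blockSum c) (elem g)).sum +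
      c (hat (blockSum c) e).last (hat (blockSum c) e).first) := rfl

/-- Inserting the decoded word between b and a replaces one block ba by the blocks of its cyclic
reading plus ba; the contribution of the outer factors cancels by e² = e. -/
theorem weightHom_eq_cyclicSum {x y : FreeProfiniteSemigroup Letter}
    (hxy : x * ofWord _ (.of b) * (ofWord _ (.of a) * y) = e) {g : MaximalSubgroup he}
    {r : FreeSemigroup ReturnWord} (hg : proj (kerCon (blockSum c)) (elem g) =
      proj (kerCon (blockSum c)) (x * ofWord _ (.of b) * ofWord _ (decode r) *
        (ofWord _ (.of a) * y))) :
    weightHom c he g = cyclicSum c r := by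
  obtain ⟨h₁, h₂, h₃⟩ := blockSum_decode c r
  have hsum := congrArg BlockSum.sum (congrArg (hat (blockSum c)) he.eq)
  have hb : blockSum c (.of b) = ⟨b, 0, b⟩ := rfl
  have ha : blockSum c (.of a) = ⟨a, 0, a⟩ := rfl
  rw [weightHom_apply, hat_congr _ hg, ← ofAdd_toAdd (cyclicSum c r), ← h₃]
  subst hxy
  simp only [map_mul, hat_ofWord, BlockSum.sum_mul, BlockSum.first_mul, BlockSum.last_mul, h₁, h₂,
    hb, ha] at hsum ⊢
  congr 1
  linear_combination hsum

end ThueMorse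

/-! ### Homomorphisms to ℤ/2 and ℤ/5 -/

namespace ThueMorse

open FreeProfiniteSemigroup Letter MaximalSubgroup

/-- The weight that is invariant under the substitution. -/
def invariantWeight (p : ℕ) : Letter → Letter → ZMod p
  | b, a => 1
  | a, b => 0
  | _, _ => -1

/-- The values on ab, abb, aab, aabb are 1, 0, 0, -1, and `returnTau` preserves them. -/
theorem cyclicSum_invariantWeight_iterate {p : ℕ} (hp : p = 2 ∨ p = 5) (N : ℕ)
    (r : FreeSemigroup ReturnWord) :
    cyclicSum (invariantWeight p) (returnTau^[N] r) = cyclicSum (invariantWeight p) r := by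
  have key : ∀ r, cyclicSum (invariantWeight p) (returnTau r) = cyclicSum (invariantWeight p) r :=
    DFunLike.congr_fun (f := (cyclicSum (invariantWeight p)).comp returnTau)
      (FreeSemigroup.hom_ext (funext fun r => by
        obtain rfl | rfl := hp <;> cases r <;> rfl))
  induction N with
  | zero => rfl
  | succ N ih => rw [Function.iterate_succ_apply', key, ih]

/-- With all weights 1 the cyclic sum is the length, and τ² multiplies lengths by 4. As 4 is
invertible modulo 5, iteration never kills a nonzero length. Modulo 3 the length would be
proportional to the invariant weight. -/
theorem cyclicSum_length_returnTau (r : FreeSemigroup ReturnWord) :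
    cyclicSum (p := 5) (fun _ _ => 1) (returnTau r) = (cyclicSum (p := 5) (fun _ _ => 1) r) ^ 4 := by
  induction r with
  | ih1 r => cases r <;> rfl
  | ih2 r s hr hs => rw [map_mul, map_mul, map_mul, hr, hs, mul_pow]

theorem cyclicSum_length_iterate_ne_one {r : FreeSemigroup ReturnWord}
    (hr : cyclicSum (p := 5) (fun _ _ => 1) r ≠ 1) (N : ℕ) :
    cyclicSum (p := 5) (fun _ _ => 1) (returnTau^[N] r) ≠ 1 := by
  induction N with
  | zero => exact hr
  | succ N ih =>
    rw [Function.iterate_succ_apply', cyclicSum_length_returnTau]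
    revert ih
    generalize cyclicSum (p := 5) (fun _ _ => 1) (returnTau^[N] r) = z
    revert z
    decide

/-- If s is the sum of the values of H on ab, abb, aab, two steps of `returnTau` modulo 2 replace
the values on the four return words by (s, 0, 0, s): a rank-one map. -/
theorem map_returnTau_returnTau (H : FreeSemigroup ReturnWord →ₙ* Multiplicative (ZMod 2))
    (r : FreeSemigroup ReturnWord) :
    H (returnTau (returnTau r)) = if H (.of .ab * .of .abb * .of .aab) = 1 then 1 else
      cyclicSum (invariantWeight 2) r := by
  induction r with
  | ih1 r =>
    cases r <;> simp only [returnTau, FreeSemigroup.lift_of, map_mul] <;>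
      generalize H (.of .ab) = x₁ <;> generalize H (.of .abb) = x₂ <;>
      generalize H (.of .aab) = x₃ <;> generalize H (.of .aabb) = x₄ <;>
      revert x₁ x₂ x₃ x₄ <;> decide
  | ih2 r s hr hs =>
    rw [map_mul, map_mul, map_mul, hr, hs, map_mul (cyclicSum _)]
    split_ifs
    · rfl
    · rfl

/-- A maximal subgroup of `J(τ)` has at most one nontrivial continuous homomorphism to `ℤ/2`. -/
theorem eq_of_exists_ne_one {e : FreeProfiniteSemigroup Letter} {he : IsIdempotentElem e}
    {Θ : FreeSemigroup ReturnWord →ₙ* MaximalSubgroup he}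
    (hgen : ∀ c (g : MaximalSubgroup he), ∃ r, proj c (elem (Θ r)) = proj c (elem g))
    (hper : ∀ c, ∃ N, 1 ≤ N ∧ ∀ r, proj c (elem (Θ (returnTau^[N] r))) = proj c (elem (Θ r)))
    {h₁ h₂ : MaximalSubgroup he →ₜ* Multiplicative (ZMod 2)} (hne₁ : ∃ g, h₁ g ≠ 1)
    (hne₂ : ∃ g, h₂ g ≠ 1) (g : MaximalSubgroup he) : h₁ g = h₂ g := by
  have key : ∀ h : MaximalSubgroup he →ₜ* Multiplicative (ZMod 2), (∃ g, h g ≠ 1) →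
      ∀ r, h (Θ r) = cyclicSum (invariantWeight 2) r := by
    rintro h ⟨g, hg⟩
    obtain ⟨c, hc⟩ := exists_proj_separating continuous_elem elem_injective h.continuous_toFun
    obtain ⟨N, hN, hNc⟩ := hper c
    let H : FreeSemigroup ReturnWord →ₙ* Multiplicative (ZMod 2) :=
      (h.toMonoidHom : MaximalSubgroup he →ₙ* Multiplicative (ZMod 2)).comp Θ
    have hH : ∀ r, H (returnTau^[N] r) = H r := fun r => hc _ _ (hNc r)
    obtain ⟨k, rfl⟩ := Nat.exists_eq_add_of_le hN
    -- Using the period N = 1 + k twice guarantees at least two steps, even when N = 1.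
    have hH' : ∀ r, H r = H (returnTau (returnTau (returnTau^[k + k] r))) := fun r => by
      rw [← hH r, ← hH, ← Function.iterate_add_apply, ← Function.iterate_succ_apply' returnTau,
        ← Function.iterate_succ_apply' returnTau]
      congr 2
      omega
    intro r
    change H r = _
    rw [hH', map_returnTau_returnTau, if_neg, cyclicSum_invariantWeight_iterate (.inl rfl)]
    intro h1
    obtain ⟨s, hs⟩ := hgen c g
    refine hg ((hc _ _ hs).symm.trans ?_)
    change H s = 1
    rw [hH', map_returnTau_returnTau, if_pos h1]
  obtain ⟨c₁, hc₁⟩ := exists_proj_separating continuous_elem elem_injective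
    (f := fun g => (h₁ g, h₂ g)) (h₁.continuous_toFun.prodMk h₂.continuous_toFun)
  obtain ⟨r, hr⟩ := hgen c₁ g
  have := Prod.ext_iff.1 (hc₁ _ _ hr)
  exact this.1.symm.trans (((key h₁ hne₁ r).trans (key h₂ hne₂ r).symm).trans this.2)

end ThueMorse

/-! ### Relatively free profinite groups -/

section RelativelyFree

variable {V : GroupPseudovariety} {G H : Type} [Group G] [TopologicalSpace G]
  [IsTopologicalGroup G] [CompactSpace G] [TotallyDisconnectedSpace G] [Group H]
  [TopologicalSpace H] [IsTopologicalGroup H] [CompactSpace H] [TotallyDisconnectedSpace H]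

theorem IsProV.of_surjective (hG : IsProV V G) (φ : G →ₜ* H) (hφ : Function.Surjective φ) :
    IsProV V H := fun N => by
  let M : OpenNormalSubgroup G :=
    { toSubgroup := N.toSubgroup.comap φ.toMonoidHom
      isOpen' := N.isOpen'.preimage φ.continuous_toFun
      isNormal' := N.isNormal'.comap φ.toMonoidHom }
  refine V.mem_of_surjective _ _ (QuotientGroup.map M.toSubgroup N.toSubgroup φ.toMonoidHom le_rfl)
    (fun x => ?_) (hG M)
  obtain ⟨y, rfl⟩ := QuotientGroup.mk_surjective x
  obtain ⟨g, rfl⟩ := hφ y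
  exact ⟨(g : G ⧸ M.toSubgroup), rfl⟩

namespace IsFreeProV

variable {X : Type u} [TopologicalSpace X] {E : Set X} {ι : X → G} (h : IsFreeProV V G E ι)

include h

theorem hom_ext (hH : IsProV V H) {φ ψ : G →ₜ* H} (hφψ : ∀ x, φ (ι x) = ψ (ι x)) : φ = ψ := by
  obtain ⟨_, -, hu⟩ := h.existsUnique_lift H hH (fun x => ψ (ι x))
    (ψ.continuous_toFun.comp h.continuous) fun x hx => by rw [h.eq_one x hx, map_one]
  rw [hu φ hφψ, hu ψ fun _ => rfl]

/-- If `χ` is the only nontrivial homomorphism from `G` to `ℤ/2`, then the nontrivial values of a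
homomorphism to `ℤ/q` on the basis are its values on the support of `χ`. -/
theorem ne_one_iff {q : ℕ} (h₂ : IsProV V (Multiplicative (ZMod 2)))
    {χ : G →ₜ* Multiplicative (ZMod 2)}
    (hχ : ∀ φ : G →ₜ* Multiplicative (ZMod 2), (∃ g, φ g ≠ 1) → ∀ g, φ g = χ g)
    (ψ : G →ₜ* Multiplicative (ZMod q)) {x : X} (hx : ψ (ι x) ≠ 1) (y : X) :
    χ (ι y) ≠ 1 ↔ ψ (ι y) = ψ (ι x) := by
  classical
  -- The indicator of a nontrivial value; it sends 1 to 1, so it respects the condition on `E`.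
  let f : Multiplicative (ZMod q) → Multiplicative (ZMod 2) := fun k =>
    if k = ψ (ι x) then .ofAdd 1 else 1
  obtain ⟨φ, hφ, -⟩ := h.existsUnique_lift _ h₂ (fun x => f (ψ (ι x)))
    ((continuous_of_discreteTopology (f := f)).comp (ψ.continuous_toFun.comp h.continuous)) fun y hy => by
      rw [h.eq_one y hy, map_one]
      exact if_neg hx.symm
  have h1 : (Multiplicative.ofAdd 1 : Multiplicative (ZMod 2)) ≠ 1 := by decide
  have hφx : φ (ι x) ≠ 1 := by
    rw [hφ]
    simp [f]
  rw [← hχ φ ⟨_, hφx⟩, hφ]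
  by_cases hy : ψ (ι y) = ψ (ι x) <;> simp [f, hy, h1]

/-- If a relatively free profinite group has exactly one nontrivial homomorphism to `ℤ/2`, then
its homomorphisms to `ℤ/5` are proportional. -/
theorem eq_pow_of_unique (h₂ : IsProV V (Multiplicative (ZMod 2)))
    (h₅ : IsProV V (Multiplicative (ZMod 5))) {χ : G →ₜ* Multiplicative (ZMod 2)}
    (hχ : ∀ φ : G →ₜ* Multiplicative (ZMod 2), (∃ g, φ g ≠ 1) → ∀ g, φ g = χ g)
    {φ ψ : G →ₜ* Multiplicative (ZMod 5)} (hφ : ∃ g, φ g ≠ 1) (hψ : ∃ g, ψ g ≠ 1) :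
    ∃ m : ℕ, ∀ g, ψ g = φ g ^ m := by
  have hne : ∀ φ : G →ₜ* Multiplicative (ZMod 5), (∃ g, φ g ≠ 1) → ∃ x, φ (ι x) ≠ 1 := by
    rintro φ ⟨g, hg⟩
    by_contra! hx
    exact hg (DFunLike.congr_fun (h.hom_ext h₅ (ψ := 1) hx) g)
  obtain ⟨x, hx⟩ := hne φ hφ
  obtain ⟨y, hy⟩ := hne ψ hψ
  have hpow : ∀ k l : Multiplicative (ZMod 5), k ≠ 1 → ∃ m : Fin 5, l = k ^ (m : ℕ) := by decide
  obtain ⟨m, hm⟩ := hpow (φ (ι x)) (ψ (ι y)) hx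
  refine ⟨m, fun g => ?_⟩
  let φm : G →ₜ* Multiplicative (ZMod 5) :=
    { toMonoidHom := (powMonoidHom (m : ℕ)).comp φ.toMonoidHom
      continuous_toFun := (continuous_pow (m : ℕ)).comp φ.continuous_toFun }
  refine DFunLike.congr_fun (h.hom_ext h₅ (φ := ψ) (ψ := φm) fun z => ?_) g
  change ψ (ι z) = φ (ι z) ^ (m : ℕ)
  -- On the support of χ both homomorphisms are constant; off it both are trivial.
  by_cases hz : χ (ι z) ≠ 1
  · rw [(h.ne_one_iff h₂ hχ φ hx z).1 hz, (h.ne_one_iff h₂ hχ ψ hy z).1 hz, hm]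
  · have h1 : φ (ι z) = 1 := by
      by_contra h1
      exact hz ((h.ne_one_iff h₂ hχ φ h1 z).2 rfl)
    have h2 : ψ (ι z) = 1 := by
      by_contra h2
      exact hz ((h.ne_one_iff h₂ hχ ψ h2 z).2 rfl)
    rw [h1, h2, one_pow]

end IsFreeProV

end RelativelyFree

/-! ### The theorem -/

open ThueMorse MaximalSubgroup in
theorem theoremt :
    (∃ e ∈ ThueMorse.jClass, IsIdempotentElem e) ∧
    ∀ (e : FreeProfiniteSemigroup ThueMorse.Letter) (he : IsIdempotentElem e),
      e ∈ ThueMorse.jClass →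
      ∀ V : GroupPseudovariety, ¬ IsRelativelyFree.{u} V (MaximalSubgroup he) := by
  refine ⟨exists_isIdempotentElem_mem_jClass, ?_⟩
  rintro e he hJ V ⟨X, _, E, ι, h⟩
  obtain ⟨x, y, Θ, hxy, hgen, hper⟩ := exists_returnHom he hJ
  have hcyc : ∀ {p : ℕ} [NeZero p] (c : Letter → Letter → ZMod p),
      ∃ N, ∀ r, weightHom c he (Θ r) = cyclicSum c (returnTau^[N] r) := fun c =>
    let ⟨N, _, hN⟩ := hper (FreeProfiniteSemigroup.kerCon (blockSum c))
    ⟨N, fun r => weightHom_eq_cyclicSum c he hxy (hN r).1⟩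
  have hinv : ∀ {p : ℕ} [NeZero p] (_ : p = 2 ∨ p = 5) (r : FreeSemigroup ReturnWord),
      weightHom (invariantWeight p) he (Θ r) = cyclicSum (invariantWeight p) r := by
    intro p _ hp r
    obtain ⟨N, hN⟩ := hcyc (invariantWeight p)
    rw [hN, cyclicSum_invariantWeight_iterate hp]
  -- Both groups are quotients of the maximal subgroup, since the invariant weight of ab is a
  -- generator.
  have hpro : ∀ {p : ℕ} [NeZero p], p = 2 ∨ p = 5 → IsProV V (Multiplicative (ZMod p)) :=
    fun {p} _ hp => h.isProV.of_surjective (weightHom (invariantWeight p) he) fun z => by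
      refine ⟨Θ (.of .ab) ^ z.toAdd.val, ?_⟩
      rw [map_pow, hinv hp]
      obtain rfl | rfl := hp <;> revert z <;> decide
  have h5 : ∃ g, weightHom (invariantWeight 5) he g ≠ 1 :=
    ⟨Θ (.of .ab), by rw [hinv (.inr rfl)]; decide⟩
  have h2 : ∃ g, weightHom (invariantWeight 2) he g ≠ 1 :=
    ⟨Θ (.of .ab), by rw [hinv (.inl rfl)]; decide⟩
  have hlen : weightHom (p := 5) (fun _ _ => 1) he (Θ (.of .abb)) ≠ 1 := by
    obtain ⟨N, hN⟩ := hcyc (p := 5) fun _ _ => 1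
    rw [hN]
    exact cyclicSum_length_iterate_ne_one (by decide) N
  obtain ⟨m, hm⟩ := h.eq_pow_of_unique (hpro (.inl rfl)) (hpro (.inr rfl))
    (fun φ hφ g => eq_of_exists_ne_one hgen
      (fun c => (hper c).imp fun N hN => ⟨hN.1, fun r => (hN.2 r).2⟩) hφ h2 g) h5 ⟨_, hlen⟩
  refine hlen ?_
  -- The invariant weight of abb is zero, so every power of that homomorphism is trivial there.
  rw [hm, hinv (.inr rfl)]
  exact one_pow m
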